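/- **Setting.** Let $N\in\mathbb N$, and write $\mathbf X=(\mathbf x_1,\dots,\mathbf x_N)\in\mathbb R^{dN}$. Let $\mathfrak h$ be a complex Hilbert space and $\omega\ge 0$ an injective self-adjoint, possibly unbounded, operator on $\mathfrak h$. Let $\mathfrak h_\omega$ be the Hilbert completion of $\bigcap_{k}\mathscr D(\omega^k)$ with respect to $\langle\,\cdot\,|\,\omega\,|\,\cdot\,\rangle_{\mathfrak h}$; the operator $\omega^{1/2}$ extends to a unitary map $\mathfrak h_\omega\to\mathfrak h$, with inverse denoted by $\omega^{-1/2}$, and for $z\in\mathfrak h_\omega$ and $v\in\mathscr D(\omega^{-1/2})$ we write $\langle z|v\rangle:=\langle\omega^{1/2}z|\omega^{-1/2}v\rangle_{\mathfrak h}$. Let $\mathcal W\in L^1_{\mathrm{loc}}(\mathbb R^{dN})$, $\mathcal W\ge0$. The quasi-classical energy is the quadratic form $\mathcal E_{\mathrm{qc}}[\psi,z]=\langle\psi|\mathcal H_z|\psi\rangle$, set equal to $+\infty$ unless $\psi\in H^1(\mathbb R^{dN})$ and $\int\mathcal W|\psi|^2<\infty$, in one of the following models. (a) *Nelson model*: $d\in\{1,2,3\}$,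 $\lambda,\omega^{-1/2}\lambda\in L^\infty(\mathbb R^d;\mathfrak h)$, and $$\mathcal H_z=\sum_{j}\bigl(-\Delta_j+2\,\mathrm{Re}\,\langle z|\lambda(\mathbf x_j)\rangle\bigr)+\mathcal W+\|z\|^2_{\mathfrak h_\omega}.$$ (b) *Polaron*: $d\in\{1,2,3\}$, $\mathfrak h=\mathfrak h_\omega=L^2(\mathbb R^d)$, $\omega=1$, $\alpha>0$, $\lambda(\mathbf x;\mathbf k)=\sqrt\alpha\,e^{-i\mathbf k\cdot\mathbf x}|\mathbf k|^{-(d-1)/2}$, and $\mathcal H_z$ as in (a), where the form of $2\,\mathrm{Re}\,\langle z|\lambda(\mathbf x_j)\rangle$ is understood as $2\sqrt\alpha\,\mathrm{Re}\,\langle\psi|\,g_<(\mathbf x_j)+[-i\nabla_j,\mathbf g_>(\mathbf x_j)]\,|\psi\rangle$ with, for any fixed $\varrho>0$, $$g_<(\mathbf x)=\int_{|\mathbf k|\le\varrho}e^{i\mathbf k\cdot\mathbf x}|\mathbf k|^{-\frac{d-1}2}z(\mathbf k)\,d\mathbf k,\qquad \mathbf g_>(\mathbf x)=\int_{|\mathbf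 k|>\varrho}e^{i\mathbf k\cdot\mathbf x}|\mathbf k|^{-\frac{d+1}2}\tfrac{\mathbf k}{|\mathbf k|}z(\mathbf k)\,d\mathbf k,$$ $$\langle\psi|[-i\nabla_j,\mathbf g_>(\mathbf x_j)]|\psi\rangle:=\langle -i\nabla_j\psi|\mathbf g_>(\mathbf x_j)\psi\rangle-\langle\psi|\mathbf g_>(\mathbf x_j)\cdot(-i\nabla_j\psi)\rangle .$$ (c) *Pauli–Fierz model*: $d=3$, $m_j>0$, $e\in\mathbb R$, $\boldsymbol\lambda_j=(\lambda_{j,1},\lambda_{j,2},\lambda_{j,3})$ with $\lambda_{j,\ell},\omega^{\pm1/2}\lambda_{j,\ell}\in L^\infty(\mathbb R^3;\mathfrak h)$ and $\nabla\cdot\boldsymbol\lambda_j=0$ weakly, and $$\mathcal H_z=\sum_j\tfrac1{2m_j}\bigl(-i\nabla_j+2e\,\mathrm{Re}\,\langle z|\boldsymbol\lambda_j(\mathbf x_j)\rangle\bigr)^2+\mathcal W+\|z\|^2_{\mathfrak h_\omega}.$$ Let $\mathcal F_{\mathrm{qc}}[\psi,\eta]:=\mathcal E_{\mathrm{qc}}[\psi,\omega^{-1/2}\eta]$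 for $\eta\in\mathfrak h$, let $\mathcal E_{\mathrm{Pekar}}[\psi]:=\inf_{\eta\in\mathfrak h}\mathcal F_{\mathrm{qc}}[\psi,\eta]$, and let $E_{\mathrm{qc}}$, $E_{\mathrm{Pekar}}$ be the infima of $\mathcal E_{\mathrm{qc}}$ and $\mathcal E_{\mathrm{Pekar}}$ over the sets $\mathscr D_{\mathrm{qc}}\subset L^2(\mathbb R^{dN})\times\mathfrak h_\omega$ and $\mathscr D_{\mathrm{Pekar}}\subset L^2(\mathbb R^{dN})$ of configurations with $\|\psi\|_2=1$ and finite energy. A minimizer is an element of the domain at which the infimum is attained. **Proposition (Equivalence of variational problems).** In each of the models (a), (b), (c): 1. $E_{\mathrm{Pekar}}=E_{\mathrm{qc}}>-\infty$. 2. If $(\psi_{\mathrm{qc}},z_{\mathrm{qc}})\in\mathscr D_{\mathrm{qc}}$ is a minimizer of $\mathcal E_{\mathrm{qc}}$, then $\psi_{\mathrm{qc}}$ is a minimizer of $\mathcal E_{\mathrm{Pekar}}$, i.e. $\mathcal E_{\mathrm{Pekar}}[\psi_{\mathrm{qc}}]=E_{\mathrm{Pekar}}$. 3. For every $\psi\in\mathscr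 D_{\mathrm{Pekar}}$ the functional $\eta\mapsto\mathcal F_{\mathrm{qc}}[\psi,\eta]$ is strictly convex on $\mathfrak h$ and has exactly one minimizer $\eta_{\mathrm{Pekar}}[\psi]\in\mathfrak h$, which is the unique solution $\eta\in\mathfrak h$ of $$\eta+\Bigl\langle\psi\Bigl|\sum_j(\omega^{-1/2}\lambda)(\mathbf x_j)\Bigr|\psi\Bigr\rangle_{L^2(\mathbb R^{dN})}=0$$ in the cases (a) and (b) (in case (b) as an identity for almost every $\mathbf k$), and in case (c), with $\boldsymbol\xi_j=\omega^{-1/2}\boldsymbol\lambda_j$, of $$\eta+\sum_j\tfrac1{m_j}\bigl\langle\psi\bigl|e\,\boldsymbol\xi_j(\mathbf x_j)\cdot(-i\nabla_j)+2e^2\,\boldsymbol\xi_j(\mathbf x_j)\cdot\mathrm{Re}\,\langle\eta|\boldsymbol\xi_j(\mathbf x_j)\rangle_{\mathfrak h}\bigr|\psi\bigr\rangle_{L^2(\mathbb R^{3N})}=0 .$$ 4. Conversely, if $\psi_{\mathrm{Pekar}}$ is a minimizer of $\mathcal E_{\mathrm{Pekar}}$ and $\eta=\eta_{\mathrm{Pekar}}[\psi_{\mathrm{Pekar}}]$,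 then $(\psi_{\mathrm{Pekar}},\omega^{-1/2}\eta)\in\mathscr D_{\mathrm{qc}}$ is a minimizer of $\mathcal E_{\mathrm{qc}}$, i.e. $\mathcal F_{\mathrm{qc}}[\psi_{\mathrm{Pekar}},\eta]=E_{\mathrm{qc}}$. -/

import Mathlib

open MeasureTheory
open scoped InnerProductSpace SchwartzMap LineDeriv

noncomputable section

/-- A non-negative self-adjoint, possibly unbounded, operator `ω` on the complex Hilbert space `𝔥`
which is injective, so that it has a (possibly unbounded) inverse. -/
structure Dispersion (𝔥 : Type*) [NormedAddCommGroup 𝔥] [InnerProductSpace ℂ 𝔥]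
    [CompleteSpace 𝔥] where
  /-- the underlying densely defined operator -/
  op : 𝔥 →ₗ.[ℂ] 𝔥
  selfAdjoint : IsSelfAdjoint op
  nonneg : ∀ x : op.domain, 0 ≤ (⟪(x : 𝔥), op x⟫_ℂ).re
  injective : ∀ x : op.domain, op x = 0 → x = 0

namespace Dispersion

variable {𝔥 : Type*} [NormedAddCommGroup 𝔥] [InnerProductSpace ℂ 𝔥] [CompleteSpace 𝔥]

/-- `S` is the non-negative self-adjoint square root of `A`: it is self-adjoint, non-negative, and
`S ∘ S = A`, domains included. -/
def IsSqrt (S A : 𝔥 →ₗ.[ℂ] 𝔥) : Prop :=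
  IsSelfAdjoint S ∧ (∀ x : S.domain, 0 ≤ (⟪(x : 𝔥), S x⟫_ℂ).re) ∧
    ∀ x y : 𝔥, (x, y) ∈ A.graph ↔ ∃ w : 𝔥, (x, w) ∈ S.graph ∧ (w, y) ∈ S.graph

theorem symm_of_isSelfAdjoint {A : 𝔥 →ₗ.[ℂ] 𝔥} (hA : IsSelfAdjoint A) {x y u v : 𝔥}
    (hx : (x, y) ∈ A.graph) (hu : (u, v) ∈ A.graph) : ⟪y, u⟫_ℂ = ⟪x, v⟫_ℂ := by
  obtain ⟨a, rfl, rfl⟩ := (LinearPMap.mem_graph_iff A).1 hx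
  obtain ⟨b, rfl, rfl⟩ := (LinearPMap.mem_graph_iff A).1 hu
  have h := LinearPMap.adjoint_isFormalAdjoint (T := A) hA.dense_domain
  rw [LinearPMap.isSelfAdjoint_def.1 hA] at h
  exact (h a b)

theorem mem_graph_of_isSelfAdjoint {A : 𝔥 →ₗ.[ℂ] 𝔥} (hA : IsSelfAdjoint A) {y w : 𝔥}
    (h : ∀ u v : 𝔥, (u, v) ∈ A.graph → ⟪w, u⟫_ℂ = ⟪y, v⟫_ℂ) : (y, w) ∈ A.graph := by
  have hy : y ∈ A.adjoint.domain :=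
    LinearPMap.mem_adjoint_domain_of_exists _ ⟨w, fun x => h x (A x) (A.mem_graph x)⟩
  have e : A.adjoint ⟨y, hy⟩ = w :=
    LinearPMap.adjoint_apply_eq hA.dense_domain ⟨y, hy⟩ (fun x => h x (A x) (A.mem_graph x))
  have m : (y, w) ∈ A.adjoint.graph := (LinearPMap.mem_graph_iff _).2 ⟨⟨y, hy⟩, rfl, e⟩
  rwa [LinearPMap.isSelfAdjoint_def.1 hA] at m

theorem isSelfAdjoint_of_graph {A : 𝔥 →ₗ.[ℂ] 𝔥} (hd : Dense (A.domain : Set 𝔥))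
    (hs : ∀ x y u v : 𝔥, (x, y) ∈ A.graph → (u, v) ∈ A.graph → ⟪y, u⟫_ℂ = ⟪x, v⟫_ℂ)
    (hm : ∀ y w : 𝔥, (∀ u v : 𝔥, (u, v) ∈ A.graph → ⟪w, u⟫_ℂ = ⟪y, v⟫_ℂ) → (y, w) ∈ A.graph) :
    IsSelfAdjoint A := by
  rw [LinearPMap.isSelfAdjoint_def]
  refine le_antisymm ?_ ?_
  · refine LinearPMap.le_of_le_graph ?_
    rintro ⟨y, w⟩ hyw
    obtain ⟨a, rfl, rfl⟩ := (LinearPMap.mem_graph_iff _).1 hyw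
    refine hm _ _ ?_
    intro u v huv
    obtain ⟨b, rfl, rfl⟩ := (LinearPMap.mem_graph_iff A).1 huv
    exact LinearPMap.adjoint_isFormalAdjoint hd a b
  · refine LinearPMap.IsFormalAdjoint.le_adjoint hd ?_
    intro a b
    exact hs _ _ _ _ (A.mem_graph a) (A.mem_graph b)

variable (ω : Dispersion 𝔥)

theorem graph_nonneg {x y : 𝔥} (h : (x, y) ∈ ω.op.graph) : 0 ≤ (⟪x, y⟫_ℂ).re := by
  obtain ⟨a, rfl, rfl⟩ := (LinearPMap.mem_graph_iff _).1 h
  exact ω.nonneg a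

theorem graph_injective {x : 𝔥} (h : (x, 0) ∈ ω.op.graph) : x = 0 := by
  obtain ⟨a, rfl, h0⟩ := (LinearPMap.mem_graph_iff _).1 h
  simpa using congrArg Subtype.val (ω.injective a h0)

theorem norm_sq_add_le {x y : 𝔥} (h : (x, y) ∈ ω.op.graph) :
    ‖x‖ ^ 2 + ‖y‖ ^ 2 ≤ ‖x + y‖ ^ 2 := by
  have h1 := norm_add_sq (𝕜 := ℂ) x y
  have h2 := ω.graph_nonneg h
  simp only [RCLike.re_to_complex] at h1
  linarith

/-- The resolvent `(1 + ω)⁻¹`. -/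
theorem exists_resolvent : ∃ R : 𝔥 →L[ℂ] 𝔥,
    (∀ y, (R y, y - R y) ∈ ω.op.graph) ∧ ∀ x y, (x, y) ∈ ω.op.graph → R (x + y) = x := by
  have hc : IsClosed (ω.op.graph : Set (𝔥 × 𝔥)) := ω.selfAdjoint.isClosed
  have : CompleteSpace ω.op.graph := hc.completeSpace_coe
  let L : ω.op.graph →L[ℂ] 𝔥 :=
    (ContinuousLinearMap.fst ℂ 𝔥 𝔥 + ContinuousLinearMap.snd ℂ 𝔥 𝔥).comp ω.op.graph.subtypeL
  have hL : ∀ p : ω.op.graph, L p = p.1.1 + p.1.2 := fun p => rfl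
  have hb : ∀ p : ω.op.graph, ‖p‖ ≤ ‖L p‖ := by
    intro p
    have h := ω.norm_sq_add_le (x := p.1.1) (y := p.1.2) p.2
    rw [hL]
    have e : ‖p‖ = max ‖p.1.1‖ ‖p.1.2‖ := rfl
    rw [e]
    refine max_le ?_ ?_
    · exact le_of_sq_le_sq (by nlinarith [sq_nonneg ‖p.1.2‖]) (norm_nonneg _)
    · exact le_of_sq_le_sq (by nlinarith [sq_nonneg ‖p.1.1‖]) (norm_nonneg _)
  have hanti : AntilipschitzWith 1 L := by
    refine AddMonoidHomClass.antilipschitz_of_bound L ?_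
    intro p; simpa using hb p
  have hker : LinearMap.ker (L : ω.op.graph →ₗ[ℂ] 𝔥) = ⊥ :=
    LinearMap.ker_eq_bot.2 hanti.injective
  have hcr : IsClosed (LinearMap.range (L : ω.op.graph →ₗ[ℂ] 𝔥) : Set 𝔥) := by
    exact hanti.isClosed_range L.uniformContinuous
  have hrange : LinearMap.range (L : ω.op.graph →ₗ[ℂ] 𝔥) = ⊤ := by
    have : (LinearMap.range (L : ω.op.graph →ₗ[ℂ] 𝔥)).topologicalClosure = ⊤ := by
      rw [Submodule.topologicalClosure_eq_top_iff, Submodule.eq_bot_iff]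
      intro y hy
      have h0 : ∀ u v : 𝔥, (u, v) ∈ ω.op.graph → ⟪-y, u⟫_ℂ = ⟪y, v⟫_ℂ := by
        intro u v huv
        have := (Submodule.mem_orthogonal' _ _).1 hy (u + v) ⟨⟨(u, v), huv⟩, rfl⟩
        rw [inner_add_right] at this
        rw [inner_neg_left]
        linear_combination -this
      have h1 := mem_graph_of_isSelfAdjoint ω.selfAdjoint h0
      have h2 := ω.norm_sq_add_le h1
      simp only [add_neg_cancel, norm_zero, norm_neg] at h2
      have : ‖y‖ = 0 := by nlinarith [norm_nonneg y]
      simpa using this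
    rwa [hcr.submodule_topologicalClosure_eq] at this
  let e := ContinuousLinearEquiv.ofBijective L hker hrange
  have he : ∀ p, e p = p.1.1 + p.1.2 := fun p => rfl
  refine ⟨(ContinuousLinearMap.fst ℂ 𝔥 𝔥).comp (ω.op.graph.subtypeL.comp
    (e.symm : 𝔥 →L[ℂ] ω.op.graph)), ?_, ?_⟩
  · intro y
    have h1 : (e.symm y).1.1 + (e.symm y).1.2 = y := by rw [← he, e.apply_symm_apply]
    have h2 := (e.symm y).2
    have h3 : (e.symm y).1.2 = y - (e.symm y).1.1 := eq_sub_of_add_eq' h1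
    have h4 : ((e.symm y).1.1, y - (e.symm y).1.1) ∈ ω.op.graph := by rw [← h3]; exact h2
    exact h4
  · intro x y h
    have : e.symm (x + y) = ⟨(x, y), h⟩ := by
      rw [ContinuousLinearEquiv.symm_apply_eq, he]
    change (e.symm (x + y)).1.1 = x
    rw [this]

/-- The resolvent `(1 + ω)⁻¹`. -/
def resolvent : 𝔥 →L[ℂ] 𝔥 := ω.exists_resolvent.choose

theorem resolvent_mem (y : 𝔥) : (ω.resolvent y, y - ω.resolvent y) ∈ ω.op.graph :=
  ω.exists_resolvent.choose_spec.1 y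

theorem resolvent_add {x y : 𝔥} (h : (x, y) ∈ ω.op.graph) : ω.resolvent (x + y) = x :=
  ω.exists_resolvent.choose_spec.2 x y h

theorem resolvent_symm (x y : 𝔥) : ⟪ω.resolvent x, y⟫_ℂ = ⟪x, ω.resolvent y⟫_ℂ := by
  have h := symm_of_isSelfAdjoint ω.selfAdjoint (ω.resolvent_mem x) (ω.resolvent_mem y)
  rw [inner_sub_left, inner_sub_right] at h
  linear_combination -h

theorem resolvent_nonneg : 0 ≤ ω.resolvent := by
  rw [ContinuousLinearMap.nonneg_iff_isPositive, ContinuousLinearMap.isPositive_def]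
  refine ⟨fun x y => ω.resolvent_symm x y, fun x => ?_⟩
  have h := ω.graph_nonneg (ω.resolvent_mem x)
  rw [inner_sub_right, Complex.sub_re] at h
  have h2 : 0 ≤ (⟪ω.resolvent x, ω.resolvent x⟫_ℂ).re := inner_self_nonneg (𝕜 := ℂ)
  change 0 ≤ (⟪ω.resolvent x, x⟫_ℂ).re
  linarith

theorem resolvent_le_one : 0 ≤ 1 - ω.resolvent := by
  rw [ContinuousLinearMap.nonneg_iff_isPositive, ContinuousLinearMap.isPositive_def]
  refine ⟨fun x y => ?_, fun x => ?_⟩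
  · simp only [ContinuousLinearMap.coe_coe, sub_apply,
      one_apply_eq_self, inner_sub_left, inner_sub_right, ω.resolvent_symm x y]
  have h := ω.graph_nonneg (ω.resolvent_mem x)
  have h2 : 0 ≤ (⟪x - ω.resolvent x, x - ω.resolvent x⟫_ℂ).re := inner_self_nonneg (𝕜 := ℂ)
  change 0 ≤ (⟪x - ω.resolvent x, x⟫_ℂ).re
  have h3 : ⟪x - ω.resolvent x, x⟫_ℂ =
      ⟪x - ω.resolvent x, x - ω.resolvent x⟫_ℂ + ⟪x - ω.resolvent x, ω.resolvent x⟫_ℂ := by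
    rw [← inner_add_right, sub_add_cancel]
  have h4 : (⟪x - ω.resolvent x, ω.resolvent x⟫_ℂ).re =
    (⟪ω.resolvent x, x - ω.resolvent x⟫_ℂ).re := inner_re_symm (𝕜 := ℂ) _ _
  rw [h3, Complex.add_re, h4]
  linarith

theorem resolvent_injective {y : 𝔥} (h : ω.resolvent y = 0) : y = 0 := by
  have h1 := ω.resolvent_mem y
  rw [h, sub_zero] at h1
  obtain ⟨a, ha, hb⟩ := (LinearPMap.mem_graph_iff _).1 h1
  have : a = 0 := Subtype.ext ha
  rw [this] at hb
  simpa using hb.symm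

theorem one_sub_resolvent_injective {y : 𝔥} (h : y - ω.resolvent y = 0) : y = 0 := by
  have h1 := ω.resolvent_mem y
  rw [h] at h1
  exact ω.resolvent_injective (ω.graph_injective h1)

theorem exists_sqrt_aux : ∃ S : 𝔥 →ₗ.[ℂ] 𝔥, IsSqrt S ω.op ∧
    ∀ u : 𝔥, (CFC.sqrt ω.resolvent u, CFC.sqrt (1 - ω.resolvent) u) ∈ S.graph := by
  set R := ω.resolvent with hR
  set A := CFC.sqrt R with hA
  set B := CFC.sqrt (1 - R) with hB
  have hA0 : 0 ≤ A := CFC.sqrt_nonneg _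
  have hB0 : 0 ≤ B := CFC.sqrt_nonneg _
  have hAA : A * A = R := CFC.sqrt_mul_sqrt_self R ω.resolvent_nonneg
  have hBB : B * B = 1 - R := CFC.sqrt_mul_sqrt_self _ ω.resolvent_le_one
  have hcomm : Commute A B := by
    have h1 : Commute R (1 - R) := (Commute.one_right R).sub_right (Commute.refl R)
    have h2 : Commute A (1 - R) := by
      rw [hA, CFC.sqrt_eq_real_sqrt R ω.resolvent_nonneg]
      exact h1.cfcₙ_real _
    rw [hB, CFC.sqrt_eq_real_sqrt (1 - R) ω.resolvent_le_one]
    exact (h2.symm.cfcₙ_real _).symm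
  have aa : ∀ u, A (A u) = R u := fun u => by rw [← hAA]; rfl
  have bb : ∀ u, B (B u) = u - R u := fun u => by
    have : (B * B) u = (1 - R) u := by rw [hBB]
    simpa using this
  have ab : ∀ u, A (B u) = B (A u) := fun u => by
    have : (A * B) u = (B * A) u := by rw [hcomm.eq]
    exact this
  have dec : ∀ u, A (A u) + B (B u) = u := fun u => by rw [aa, bb]; simp
  have sA : ∀ u v, ⟪A u, v⟫_ℂ = ⟪u, A v⟫_ℂ :=
    ((ContinuousLinearMap.nonneg_iff_isPositive _).1 hA0).isSymmetric
  have sB : ∀ u v, ⟪B u, v⟫_ℂ = ⟪u, B v⟫_ℂ :=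
    ((ContinuousLinearMap.nonneg_iff_isPositive _).1 hB0).isSymmetric
  have injA : ∀ u, A u = 0 → u = 0 := fun u hu => by
    apply ω.resolvent_injective
    rw [← hR, ← aa, hu, map_zero]
  let G : Submodule ℂ (𝔥 × 𝔥) := LinearMap.range ((A : 𝔥 →ₗ[ℂ] 𝔥).prod (B : 𝔥 →ₗ[ℂ] 𝔥))
  have hG : ∀ x y, (x, y) ∈ G ↔ ∃ u, A u = x ∧ B u = y := by
    intro x y
    constructor
    · rintro ⟨u, hu⟩
      exact ⟨u, congrArg Prod.fst hu, congrArg Prod.snd hu⟩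
    · rintro ⟨u, rfl, rfl⟩
      exact ⟨u, rfl⟩
  have hgr : G.toLinearPMap.graph = G := by
    refine Submodule.toLinearPMap_graph_eq G ?_
    rintro ⟨x, y⟩ hx h0
    obtain ⟨u, hu1, hu2⟩ := (hG x y).1 hx
    simp only at h0
    rw [h0] at hu1
    rw [injA u hu1, map_zero] at hu2
    exact hu2.symm
  have hS : ∀ x y, (x, y) ∈ G.toLinearPMap.graph ↔ ∃ u, A u = x ∧ B u = y := by
    intro x y; rw [hgr]; exact hG x y
  refine ⟨G.toLinearPMap, ⟨?_, ?_, ?_⟩, fun u => (hS _ _).2 ⟨u, rfl, rfl⟩⟩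
  · refine isSelfAdjoint_of_graph ?_ ?_ ?_
    · rw [Submodule.dense_iff_topologicalClosure_eq_top, Submodule.topologicalClosure_eq_top_iff,
        Submodule.eq_bot_iff]
      intro y hy
      refine injA y (ext_inner_right ℂ fun u => ?_)
      rw [sA, inner_zero_left]
      obtain ⟨a, ha, -⟩ := (LinearPMap.mem_graph_iff _).1 ((hS (A u) (B u)).2 ⟨u, rfl, rfl⟩)
      refine (Submodule.mem_orthogonal' _ _).1 hy (A u) ?_
      rw [← show (a : 𝔥) = A u from ha]
      exact a.2
    · intro x y u v hxy huv
      obtain ⟨a, rfl, rfl⟩ := (hS _ _).1 hxy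
      obtain ⟨b, rfl, rfl⟩ := (hS _ _).1 huv
      rw [sB, sA, ab]
    · intro y w h
      have h1 : A w = B y := by
        refine ext_inner_right ℂ fun u => ?_
        rw [sA, sB]
        exact h (A u) (B u) ((hS _ _).2 ⟨u, rfl, rfl⟩)
      refine (hS _ _).2 ⟨A y + B w, ?_, ?_⟩
      · rw [map_add, ab, h1, dec]
      · rw [map_add, ← ab, ← h1, dec]
  · intro x
    obtain ⟨u, hu1, hu2⟩ := (hS _ _).1 (G.toLinearPMap.mem_graph x)
    rw [← hu1, ← hu2]
    have h := (ContinuousLinearMap.nonneg_iff_isPositive _).1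
      ((commute_iff_mul_nonneg hA0 hB0).1 hcomm)
    have h2 := h.re_inner_nonneg_right u
    rw [sA]
    exact h2
  · intro x y
    constructor
    · intro h
      have hx := ω.resolvent_add h
      rw [← hR] at hx
      refine ⟨B (A (x + y)), (hS _ _).2 ⟨A (x + y), ?_, rfl⟩, (hS _ _).2 ⟨B (x + y), ab _, ?_⟩⟩
      · rw [aa, hx]
      · rw [bb, hx]; simp
    · rintro ⟨w, h1, h2⟩
      obtain ⟨u, rfl, rfl⟩ := (hS _ _).1 h1
      obtain ⟨v, hv1, rfl⟩ := (hS _ _).1 h2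
      have e1 : R (A u + B v) = A u := by
        rw [← aa, map_add, ab, hv1, dec]
      have e2 : A u + B v - R (A u + B v) = B v := by rw [e1]; simp
      have h3 := ω.resolvent_mem (A u + B v)
      rw [← hR, e2, e1] at h3
      exact h3

/-- The operator `ω^{1/2}`, i.e. the non-negative self-adjoint square root of `ω`. -/
def half : 𝔥 →ₗ.[ℂ] 𝔥 := ω.exists_sqrt_aux.choose

theorem half_isSqrt : IsSqrt ω.half ω.op := ω.exists_sqrt_aux.choose_spec.1

theorem half_mem_graph (u : 𝔥) :
    (CFC.sqrt ω.resolvent u, CFC.sqrt (1 - ω.resolvent) u) ∈ ω.half.graph :=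
  ω.exists_sqrt_aux.choose_spec.2 u

/-- The operator `ω^{-1/2}`, with domain the range of `ω^{1/2}`. -/
def negHalf : 𝔥 →ₗ.[ℂ] 𝔥 := ω.half.inverse

/-- The vector `ω^{1/2} v` for `v` in the domain of `ω^{1/2}` (and `0` otherwise). -/
def halfApply (v : 𝔥) : 𝔥 :=
  open scoped Classical in if h : v ∈ ω.half.domain then ω.half ⟨v, h⟩ else 0

/-- The vector `ω^{-1/2} v` for `v` in the domain of `ω^{-1/2}` (and `0` otherwise). -/
def negHalfApply (v : 𝔥) : 𝔥 :=
  open scoped Classical in if h : v ∈ ω.negHalf.domain then ω.negHalf ⟨v, h⟩ else 0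

/-- The domain `𝓓(ω^k)` of the powers of `ω`. -/
def domPow : ℕ → Submodule ℂ 𝔥
  | 0 => ⊤
  | k + 1 => ((domPow k).comap ω.op.toFun).map ω.op.domain.subtype

theorem mem_domPow_succ {k : ℕ} {x : 𝔥} :
    x ∈ ω.domPow (k + 1) ↔ ∃ y, (x, y) ∈ ω.op.graph ∧ y ∈ ω.domPow k := by
  constructor
  · rintro ⟨a, ha, rfl⟩
    exact ⟨ω.op a, ω.op.mem_graph a, ha⟩
  · rintro ⟨y, h, hy⟩
    obtain ⟨a, rfl, rfl⟩ := (LinearPMap.mem_graph_iff _).1 h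
    exact ⟨a, hy, rfl⟩

/-- The vectors `⋂ₖ 𝓓(ω^k)`. -/
def smoothVectors : Submodule ℂ 𝔥 := ⨅ k, ω.domPow k

theorem smoothVectors_le_domain : ω.smoothVectors ≤ ω.op.domain := by
  intro x hx
  obtain ⟨a, -, rfl⟩ := (Submodule.mem_iInf _).1 hx 1
  exact a.2

/-- The space `⋂ₖ 𝓓(ω^k)`, to be equipped with the scalar product `⟨x, ω y⟩`. -/
def FieldCore : Type _ := ω.smoothVectors

instance : AddCommGroup ω.FieldCore := inferInstanceAs (AddCommGroup ω.smoothVectors)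

instance : Module ℂ ω.FieldCore := inferInstanceAs (Module ℂ ω.smoothVectors)

/-- The inclusion of `⋂ₖ 𝓓(ω^k)` in the domain of `ω`. -/
def toDomain : ω.FieldCore →ₗ[ℂ] ω.op.domain :=
  Submodule.inclusion ω.smoothVectors_le_domain

/-- The scalar product `⟨x, ω y⟩` on `⋂ₖ 𝓓(ω^k)`. -/
@[reducible]
def fieldPreCore : PreInnerProductSpace.Core ℂ ω.FieldCore where
  inner x y := ⟪(ω.toDomain x : 𝔥), ω.op (ω.toDomain y)⟫_ℂ
  conj_inner_symm x y := by
    rw [inner_conj_symm]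
    exact symm_of_isSelfAdjoint ω.selfAdjoint (ω.op.mem_graph _) (ω.op.mem_graph _)
  re_inner_nonneg x := ω.nonneg _
  add_left x y z := by simp
  smul_left x y r := by simp [mul_comm]

instance : SeminormedAddCommGroup ω.FieldCore :=
  InnerProductSpace.Core.toSeminormedAddCommGroup (c := ω.fieldPreCore)

instance : InnerProductSpace ℂ ω.FieldCore := InnerProductSpace.ofCore ω.fieldPreCore

theorem fieldCore_norm_sq (x : ω.FieldCore) :
    ‖x‖ ^ 2 = (⟪(ω.toDomain x : 𝔥), ω.op (ω.toDomain x)⟫_ℂ).re :=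
  norm_sq_eq_re_inner (𝕜 := ℂ) x

/-- The classical field space `𝔥_ω`: the Hilbert completion of `⋂ₖ 𝓓(ω^k)` with respect to the
scalar product `⟨x, ω y⟩`. -/
abbrev FieldSpace : Type _ := UniformSpace.Completion ω.FieldCore

theorem smoothVectors_le_half_domain : ω.smoothVectors ≤ ω.half.domain := by
  intro x hx
  have h := ω.op.mem_graph ⟨x, ω.smoothVectors_le_domain hx⟩
  obtain ⟨w, hw, -⟩ := (ω.half_isSqrt.2.2 _ _).1 h
  obtain ⟨a, ha, -⟩ := (LinearPMap.mem_graph_iff _).1 hw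
  rw [← show (a : 𝔥) = x from ha]
  exact a.2

/-- The restriction of `ω^{1/2}` to `⋂ₖ 𝓓(ω^k)`. -/
def halfCoreLin : ω.FieldCore →ₗ[ℂ] 𝔥 :=
  ω.half.toFun.comp (Submodule.inclusion ω.smoothVectors_le_half_domain)

theorem halfCoreLin_mem (x : ω.FieldCore) :
    ((ω.toDomain x : 𝔥), ω.halfCoreLin x) ∈ ω.half.graph :=
  ω.half.mem_graph (Submodule.inclusion ω.smoothVectors_le_half_domain x)

theorem norm_halfCoreLin (x : ω.FieldCore) : ‖ω.halfCoreLin x‖ = ‖x‖ := by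
  have h : ‖ω.halfCoreLin x‖ ^ 2 = ‖x‖ ^ 2 := by
    rw [fieldCore_norm_sq]
    obtain ⟨w, hw1, hw2⟩ := (ω.half_isSqrt.2.2 _ _).1 (ω.op.mem_graph (ω.toDomain x))
    have e : w = ω.halfCoreLin x := LinearPMap.mem_graph_snd_inj' _ hw1 (ω.halfCoreLin_mem x) rfl
    rw [← symm_of_isSelfAdjoint ω.half_isSqrt.1 hw1 hw2, e]
    exact norm_sq_eq_re_inner (𝕜 := ℂ) _
  exact (sq_eq_sq₀ (norm_nonneg _) (norm_nonneg _)).1 h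

/-- The restriction of `ω^{1/2}` to `⋂ₖ 𝓓(ω^k)` is an isometry for the norm of `𝔥_ω`. -/
def halfCore : ω.FieldCore →ₗᵢ[ℂ] 𝔥 := ⟨ω.halfCoreLin, ω.norm_halfCoreLin⟩

theorem resolvent_pow_mem (k : ℕ) (v : 𝔥) : (ω.resolvent ^ k) v ∈ ω.domPow k := by
  induction k generalizing v with
  | zero => exact Submodule.mem_top
  | succ k ih =>
    refine ω.mem_domPow_succ.2 ⟨_, ?_, ih (v - ω.resolvent v)⟩
    have h := ω.resolvent_mem ((ω.resolvent ^ k) v)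
    have e : ω.resolvent ((ω.resolvent ^ k) v) = (ω.resolvent ^ k) (ω.resolvent v) := by
      have : (ω.resolvent * ω.resolvent ^ k) v = (ω.resolvent ^ k * ω.resolvent) v := by
        rw [← pow_succ, ← pow_succ']
      exact this
    rw [map_sub, ← e, pow_succ']
    exact h

theorem cfc_mem_smoothVectors {δ : ℝ} (hδ : 0 < δ) (v : 𝔥) :
    cfc (fun t : ℝ => max 0 (t - δ)) ω.resolvent v ∈ ω.smoothVectors := by
  have hsa : IsSelfAdjoint ω.resolvent := .of_nonneg ω.resolvent_nonneg
  refine (Submodule.mem_iInf _).2 fun k => ?_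
  have hc : Continuous fun t : ℝ => max 0 (t - δ) / (max t δ) ^ k := by
    refine Continuous.div (by fun_prop) (by fun_prop) fun t => ?_
    have : 0 < max t δ := lt_max_of_lt_right hδ
    positivity
  have e : (fun t : ℝ => max 0 (t - δ)) = fun t => t ^ k * (max 0 (t - δ) / (max t δ) ^ k) := by
    funext t
    rcases le_total t δ with h | h
    · simp [max_eq_left (sub_nonpos.2 h)]
    · have : t ≠ 0 := by linarith
      rw [max_eq_left h]
      field_simp
  rw [e, cfc_mul (fun t : ℝ => t ^ k) _ _ (by fun_prop) hc.continuousOn, cfc_pow_id _ _]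
  exact ω.resolvent_pow_mem k _

theorem denseRange_halfCore : DenseRange ω.halfCore := by
  have hsa : IsSelfAdjoint ω.resolvent := .of_nonneg ω.resolvent_nonneg
  set R := ω.resolvent with hR
  set A := CFC.sqrt R with hA
  set B := CFC.sqrt (1 - R) with hB
  have hB0 : 0 ≤ B := CFC.sqrt_nonneg _
  have sB : ∀ u v, ⟪B u, v⟫_ℂ = ⟪u, B v⟫_ℂ :=
    ((ContinuousLinearMap.nonneg_iff_isPositive _).1 hB0).isSymmetric
  have hBB : B * B = 1 - R := CFC.sqrt_mul_sqrt_self _ ω.resolvent_le_one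
  let Q : ℝ → 𝔥 →L[ℂ] 𝔥 := fun δ => cfc (fun t : ℝ => max 0 (t - δ)) R
  have sQ : ∀ δ u v, ⟪Q δ u, v⟫_ℂ = ⟪u, Q δ v⟫_ℂ := fun δ =>
    ContinuousLinearMap.isSelfAdjoint_iff_isSymmetric.1 (cfc_predicate _ _)
  have hAQ : ∀ δ u, A (Q δ u) = Q δ (A u) := by
    intro δ u
    have h1 : Commute R (Q δ) := ((Commute.refl R).cfc_real _).symm
    have h2 : Commute A (Q δ) := by
      rw [hA, CFC.sqrt_eq_real_sqrt R ω.resolvent_nonneg]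
      exact h1.cfcₙ_real _
    have : (A * Q δ) u = (Q δ * A) u := by rw [h2.eq]
    exact this
  have hd : ((LinearMap.range ω.halfCore.toLinearMap).topologicalClosure) = ⊤ := by
    rw [Submodule.topologicalClosure_eq_top_iff, Submodule.eq_bot_iff]
    intro y hy
    have h1 : ∀ δ, 0 < δ → Q δ (B y) = 0 := by
      intro δ hδ
      refine ext_inner_right ℂ fun u => ?_
      rw [sQ, sB, inner_zero_left]
      have hx : A (Q δ u) ∈ ω.smoothVectors := by
        rw [hAQ]; exact ω.cfc_mem_smoothVectors hδ _
      have e : ω.halfCore ⟨A (Q δ u), hx⟩ = B (Q δ u) :=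
        LinearPMap.mem_graph_snd_inj' _ (ω.halfCoreLin_mem ⟨A (Q δ u), hx⟩)
          (ω.half_mem_graph (Q δ u)) rfl
      exact (Submodule.mem_orthogonal' _ _).1 hy _ ⟨⟨A (Q δ u), hx⟩, e⟩
    have h2 : ∀ δ, 0 < δ → ‖R - Q δ‖ ≤ δ := by
      intro δ hδ
      have e : R - Q δ = cfc (fun t : ℝ => t - max 0 (t - δ)) R := by
        rw [cfc_sub (fun t : ℝ => t) _ R (by fun_prop) (by fun_prop), cfc_id' ℝ R]
      rw [e]
      refine norm_cfc_le hδ.le fun t ht => ?_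
      have ht0 : 0 ≤ t := spectrum_nonneg_of_nonneg ω.resolvent_nonneg ht
      rw [Real.norm_eq_abs, abs_le]
      rcases le_total t δ with h | h
      · rw [max_eq_left (by linarith)]; constructor <;> linarith
      · rw [max_eq_right (by linarith)]; constructor <;> linarith
    have h3 : R (B y) = 0 := by
      have hb : ∀ δ, 0 < δ → ‖R (B y)‖ ≤ δ * ‖B y‖ := by
        intro δ hδ
        have e : R (B y) = (R - Q δ) (B y) := by simp [h1 δ hδ]
        rw [e]
        exact (ContinuousLinearMap.le_opNorm _ _).trans
          (mul_le_mul_of_nonneg_right (h2 δ hδ) (norm_nonneg _))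
      have : ‖R (B y)‖ ≤ 0 := by
        refine le_of_forall_pos_le_add fun ε hε => ?_
        have := hb (ε / (‖B y‖ + 1)) (by positivity)
        refine this.trans ?_
        rw [zero_add, div_mul_eq_mul_div, div_le_iff₀ (by positivity)]
        nlinarith [norm_nonneg (B y)]
      simpa using this
    have h4 : B y = 0 := ω.resolvent_injective h3
    apply ω.one_sub_resolvent_injective
    have : (B * B) y = (1 - R) y := by rw [hBB]
    have h5 : B (B y) = y - R y := this
    rw [← hR, ← h5, h4, map_zero]
  have := Submodule.dense_iff_topologicalClosure_eq_top.2 hd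
  exact this

/-- The continuous extension of `ω^{1/2}` to `𝔥_ω`, as a linear map. -/
def halfExtL : ω.FieldSpace →L[ℂ] 𝔥 :=
  ω.halfCore.toContinuousLinearMap.extend
    (UniformSpace.Completion.toComplL (𝕜 := ℂ) (E := ω.FieldCore))

theorem halfExtL_coe (x : ω.FieldCore) :
    ω.halfExtL (x : ω.FieldSpace) = ω.halfCore x :=
  ContinuousLinearMap.extend_eq ω.halfCore.toContinuousLinearMap
    UniformSpace.Completion.denseRange_coe
    (UniformSpace.Completion.isUniformInducing_coe _) x

theorem norm_halfExtL (z : ω.FieldSpace) : ‖ω.halfExtL z‖ = ‖z‖ := by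
  induction z using UniformSpace.Completion.induction_on with
  | hp => exact isClosed_eq (by fun_prop) (by fun_prop)
  | ih x => rw [halfExtL_coe, LinearIsometry.norm_map, UniformSpace.Completion.norm_coe]

theorem halfExtL_surjective : Function.Surjective ω.halfExtL := by
  have hi : Isometry ω.halfExtL := AddMonoidHomClass.isometry_of_norm _ ω.norm_halfExtL
  have hc : IsClosed (Set.range ω.halfExtL) := hi.isClosedEmbedding.isClosed_range
  have hd : DenseRange ω.halfExtL := by
    refine ω.denseRange_halfCore.mono ?_
    rintro _ ⟨x, rfl⟩
    exact ⟨x, ω.halfExtL_coe x⟩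
  rw [← Set.range_eq_univ, ← hc.closure_eq]
  exact hd.closure_range

/-- The unitary map `𝔥_ω → 𝔥`, `z ↦ η = ω^{1/2} z`, extending `ω^{1/2}` from `⋂ₖ 𝓓(ω^k)` by
continuity; its inverse is `η ↦ ω^{-1/2} η`. -/
def halfIso : ω.FieldSpace ≃ₗᵢ[ℂ] 𝔥 :=
  LinearIsometryEquiv.ofSurjective ⟨ω.halfExtL.toLinearMap, ω.norm_halfExtL⟩ ω.halfExtL_surjective

/-- The pairing `⟨z, v⟩_𝔥 = ⟨ω^{1/2} z, ω^{-1/2} v⟩_𝔥` of a field `z ∈ 𝔥_ω` with a vector `v` in the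
domain of `ω^{-1/2}`. -/
def pairing (z : ω.FieldSpace) (v : 𝔥) : ℂ := ⟪ω.halfIso z, ω.negHalfApply v⟫_ℂ

end Dispersion

/-! ### The particles -/

/-- The space `ℝ^d` of one particle. -/
abbrev Position (d : ℕ) : Type := EuclideanSpace ℝ (Fin d)

/-- The configuration space `ℝ^{dN}`; the coordinate `(j, ℓ)` is the `ℓ`-th coordinate of the
`j`-th particle. -/
abbrev Config (d N : ℕ) : Type := EuclideanSpace ℝ (Fin N × Fin d)

/-- The position `x_j` of the `j`-th particle. -/
def particle {d N : ℕ} (j : Fin N) (X : Config d N) : Position d :=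
  WithLp.toLp 2 fun ℓ => X (j, ℓ)

/-- The particle Hilbert space `L²(ℝ^{dN})`. -/
abbrev Wave (d N : ℕ) : Type := Lp ℂ 2 (volume : Measure (Config d N))

/-- `ψ ∈ H¹(ℝ^{dN})`. -/
def InH1 {d N : ℕ} (ψ : Wave d N) : Prop :=
  TemperedDistribution.MemSobolev 1 2 (ψ : 𝓢'(Config d N, ℂ))

/-- `g ∈ L²` is the distributional derivative of `ψ` in the `ℓ`-th coordinate of particle `j`. -/
def HasWeakPartial {d N : ℕ} (ψ : Wave d N) (j : Fin N) (ℓ : Fin d) (g : Wave d N) : Prop :=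
  ∂_{(EuclideanSpace.single (j, ℓ) (1 : ℝ) : Config d N)} (ψ : 𝓢'(Config d N, ℂ)) =
    (g : 𝓢'(Config d N, ℂ))

/-- The component `-i ∂_{j,ℓ} ψ` of `-i ∇_j ψ`, for `ψ ∈ H¹` (and `0` if the distributional
derivative is not in `L²`). -/
def momentum {d N : ℕ} (ψ : Wave d N) (j : Fin N) (ℓ : Fin d) : Wave d N :=
  open scoped Classical in
  if h : ∃ g, HasWeakPartial ψ j ℓ g then (-Complex.I) • h.choose else 0

/-- The form domain `𝒬(-Δ + W)`: the `ψ ∈ H¹` with `∫ W |ψ|² < ∞`. -/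
def formDomain {d N : ℕ} (W : Config d N → ℝ) : Set (Wave d N) :=
  {ψ | InH1 ψ ∧ Integrable fun X => W X * ‖ψ X‖ ^ 2}

/-- The quadratic form of `𝒦₀ = ∑_j (-Δ_j) + W`, on its form domain. -/
def freeForm {d N : ℕ} (W : Config d N → ℝ) (ψ : Wave d N) : ℝ :=
  (∑ j, ∑ ℓ, ‖momentum ψ j ℓ‖ ^ 2) + ∫ X, W X * ‖ψ X‖ ^ 2

/-- An admissible external potential: `W ∈ L¹_loc`, `W ≥ 0`. -/
def IsPotential {d N : ℕ} (W : Config d N → ℝ) : Prop :=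
  LocallyIntegrable W ∧ ∀ᵐ X, 0 ≤ W X

/-! ### The Nelson model -/

section Models

variable {𝔥 : Type*} [NormedAddCommGroup 𝔥] [InnerProductSpace ℂ 𝔥] [CompleteSpace 𝔥]

/-- `v ∈ L^∞(ℝ^d; 𝔥)`, `v(x)` lies in the domain of `ω^{-1/2}` for almost all `x`, and
`ω^{-1/2} v ∈ L^∞(ℝ^d; 𝔥)`. -/
def IsFormFactor (ω : Dispersion 𝔥) {d : ℕ} (v : Position d → 𝔥) : Prop :=
  MemLp v ⊤ ∧ (∀ᵐ x, v x ∈ ω.negHalf.domain) ∧ MemLp (fun x => ω.negHalfApply (v x)) ⊤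

/-- The quasi-classical energy `⟨ψ, 𝓗_z ψ⟩` of the Nelson model, as a quadratic form, with
`𝓗_z = 𝒦₀ + ∑_j 2 Re ⟨z, lam(x_j)⟩ + ⟨z, ω z⟩`; it is `+∞` outside of the form domain. -/
def nelsonEnergy {d N : ℕ} (ω : Dispersion 𝔥) (lam : Position d → 𝔥) (W : Config d N → ℝ)
    (ψ : Wave d N) (z : ω.FieldSpace) : EReal :=
  open scoped Classical in
  if ψ ∈ formDomain W then
    ((freeForm W ψ + (∫ X, (∑ j, 2 * (ω.pairing z (lam (particle j X))).re) * ‖ψ X‖ ^ 2)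
      + ‖z‖ ^ 2 : ℝ) : EReal)
  else ⊤

/-- The equation `η + ⟨ψ, Λ ψ⟩ = 0` in `𝔥`, where `Λ(X) = ∑_j (ω^{-1/2} lam)(x_j)`. -/
def nelsonFieldEq {d N : ℕ} (ω : Dispersion 𝔥) (lam : Position d → 𝔥)
    (ψ : Wave d N) (η : 𝔥) : Prop :=
  η + ∫ X, (‖ψ X‖ ^ 2) • ∑ j, ω.negHalfApply (lam (particle j X)) = 0

/-! ### The Pauli-Fierz model -/

/-- The weak Coulomb gauge condition `∇ · v = 0` for `v : ℝ³ → 𝔥³`. -/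
def IsDivergenceFree (v : Fin 3 → Position 3 → 𝔥) : Prop :=
  ∀ φ : Position 3 → ℝ, ContDiff ℝ ((⊤ : ℕ∞) : WithTop ℕ∞) φ → HasCompactSupport φ →
    ∫ x, ∑ ℓ, (fderiv ℝ φ x (EuclideanSpace.single ℓ 1)) • v ℓ x = 0

/-- The component `ℓ` of the classical vector potential, `a_{z,j}(x) = 2 Re ⟨z, lam_j(x)⟩`. -/
def vectorPotential {N : ℕ} (ω : Dispersion 𝔥) (lam : Fin N → Fin 3 → Position 3 → 𝔥)
    (z : ω.FieldSpace) (j : Fin N) (ℓ : Fin 3) (x : Position 3) : ℝ :=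
  2 * (ω.pairing z (lam j ℓ x)).re

/-- The quasi-classical energy `⟨ψ, 𝓗_z ψ⟩` of the Pauli-Fierz model, as a quadratic form, with
`𝓗_z = ∑_j (2 m_j)⁻¹ (-i ∇_j + e a_{z,j}(x_j))² + W + ⟨z, ω z⟩`; it is `+∞` outside of the form
domain. -/
def pauliFierzEnergy {N : ℕ} (ω : Dispersion 𝔥) (m : Fin N → ℝ) (e : ℝ)
    (lam : Fin N → Fin 3 → Position 3 → 𝔥) (W : Config 3 N → ℝ)
    (ψ : Wave 3 N) (z : ω.FieldSpace) : EReal :=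
  open scoped Classical in
  if ψ ∈ formDomain W then
    (((∑ j, 1 / (2 * m j) * (∑ ℓ, (∫ X, ‖momentum ψ j ℓ X
        + (e * vectorPotential ω lam z j ℓ (particle j X) : ℝ) * ψ X‖ ^ 2)))
      + (∫ X, W X * ‖ψ X‖ ^ 2) + ‖z‖ ^ 2 : ℝ) : EReal)
  else ⊤

/-- The equation
`η + ∑_j m_j⁻¹ ⟨ψ, (e ξ_j · (-i ∇_j) + 2 e² ξ_j · Re ⟨η, ξ_j⟩) ψ⟩ = 0` in `𝔥`, where
`ξ_j = (ω^{-1/2} lam_j)(x_j)`. -/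
def pauliFierzFieldEq {N : ℕ} (ω : Dispersion 𝔥) (m : Fin N → ℝ) (e : ℝ)
    (lam : Fin N → Fin 3 → Position 3 → 𝔥) (ψ : Wave 3 N) (η : 𝔥) : Prop :=
  η + ∑ j, (1 / m j) • ∑ ℓ, ∫ X,
    (e * (starRingEnd ℂ (ψ X) * momentum ψ j ℓ X)
      + 2 * e ^ 2 * (⟪η, ω.negHalfApply (lam j ℓ (particle j X))⟫_ℂ).re * ‖ψ X‖ ^ 2 : ℂ)
      • ω.negHalfApply (lam j ℓ (particle j X)) = 0

end Models

/-! ### The polaron -/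

/-- The field space `L²(ℝ^d)` of the polaron. -/
abbrev PhononSpace (d : ℕ) : Type := Lp ℂ 2 (volume : Measure (Position d))

/-- The low-momentum form factor `1_{|k| ≤ ϱ} |k|^{-(d-1)/2}`. -/
def lowFactor (d : ℕ) (ϱ : ℝ) (k : Position d) : ℝ :=
  if ‖k‖ ≤ ϱ then ‖k‖ ^ (-((d : ℝ) - 1) / 2) else 0

/-- The component `ℓ` of the high-momentum form factor `1_{|k| > ϱ} |k|^{-(d+1)/2} k / |k|`. -/
def highFactor (d : ℕ) (ϱ : ℝ) (ℓ : Fin d) (k : Position d) : ℝ :=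
  if ϱ < ‖k‖ then ‖k‖ ^ (-((d : ℝ) + 1) / 2) * (k ℓ / ‖k‖) else 0

/-- The inverse Fourier integral `∫ e^{i k · x} f(k) z(k) dk`. -/
def invFourierInt {d : ℕ} (f : Position d → ℝ) (z : PhononSpace d) (x : Position d) : ℂ :=
  ∫ k, Complex.exp (Complex.I * (⟪k, x⟫_ℝ : ℝ)) * (f k : ℂ) * z k

/-- The quadratic form `⟨ψ, [-i ∇_j, G(x_j)] ψ⟩ = ⟨-i ∇_j ψ, G(x_j) ψ⟩ - ⟨ψ, G(x_j) · (-i ∇_j ψ)⟩`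
for a bounded vector function `G` on `ℝ^d`. -/
def commutatorForm {d N : ℕ} (G : Fin d → Position d → ℂ) (j : Fin N) (ψ : Wave d N) : ℂ :=
  ∑ ℓ, ∫ X, (starRingEnd ℂ (momentum ψ j ℓ X) * (G ℓ (particle j X) * ψ X)
    - starRingEnd ℂ (ψ X) * (G ℓ (particle j X) * momentum ψ j ℓ X))

/-- The quadratic form of the polaron potential
`𝒱_z(x) = 2 Re ⟨z, lam(x)⟩`, `lam(x; k) = √α e^{-i k · x} / |k|^{(d-1)/2}`, in the variable `x_j`.
Since `lam(x) ∉ L²(ℝ^d)`, it is understood through the splitting, at the momentum `ϱ > 0`,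
`conj ⟨z, lam(x)⟩ = √α (𝓕⁻¹[lam_< z](x) + [-i ∇_x, 𝓕⁻¹[lam_> z](x)])`,
where both inverse Fourier transforms are bounded functions. -/
def polaronPotentialForm {d N : ℕ} (α ϱ : ℝ) (z : PhononSpace d) (j : Fin N) (ψ : Wave d N) : ℝ :=
  √α * (2 * ((∫ X, invFourierInt (lowFactor d ϱ) z (particle j X) * (‖ψ X‖ ^ 2 : ℝ))
    + commutatorForm (fun ℓ => invFourierInt (highFactor d ϱ ℓ) z) j ψ).re)

/-- The quasi-classical energy `⟨ψ, 𝓗_z ψ⟩` of the polaron, as a quadratic form, with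
`𝓗_z = 𝒦₀ + ∑_j 𝒱_z(x_j) + ‖z‖²`; it is `+∞` outside of the form domain. -/
def polaronEnergy {d N : ℕ} (α ϱ : ℝ) (W : Config d N → ℝ)
    (ψ : Wave d N) (z : PhononSpace d) : EReal :=
  open scoped Classical in
  if ψ ∈ formDomain W then
    ((freeForm W ψ + (∑ j, polaronPotentialForm α ϱ z j ψ) + ‖z‖ ^ 2 : ℝ) : EReal)
  else ⊤

/-- The form factor `lam(x; k) = √α e^{-i k · x} / |k|^{(d-1)/2}` of the polaron. -/
def polaronFactor {d : ℕ} (α : ℝ) (x k : Position d) : ℂ :=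
  √α * (Complex.exp (-Complex.I * (⟪k, x⟫_ℝ : ℝ)) / (‖k‖ ^ (((d : ℝ) - 1) / 2) : ℝ))

/-- The equation `η + ⟨ψ, Λ ψ⟩ = 0` in `L²(ℝ^d)`, where `Λ(X; k) = ∑_j lam(x_j; k)`. -/
def polaronFieldEq {d N : ℕ} (α : ℝ) (ψ : Wave d N) (η : PhononSpace d) : Prop :=
  ∀ᵐ k, η k + ∫ X, (∑ j, polaronFactor α (particle j X) k) * (‖ψ X‖ ^ 2 : ℝ) = 0

/-! ### The variational problems

In this section `E` is a quasi-classical functional of `ψ` in the normed space `L` and `z` in the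
field space `Z`, with values in the extended reals, and `T : Z → 𝔥` is the change of variables
`η = ω^{1/2} z`. -/

section Variational

variable {L Z 𝔥 : Type*} [NormedAddCommGroup L] [NormedAddCommGroup Z] [InnerProductSpace ℂ Z]
  [NormedAddCommGroup 𝔥] [InnerProductSpace ℂ 𝔥]

/-- The domain of normalized configurations `(ψ, z)` of finite energy. -/
def domQc (E : L → Z → EReal) : Set (L × Z) :=
  {p | ‖p.1‖ = 1 ∧ E p.1 p.2 ≠ ⊤ ∧ E p.1 p.2 ≠ ⊥}

/-- The quasi-classical ground state energy. -/
def energyQc (E : L → Z → EReal) : EReal := ⨅ p ∈ domQc E, E p.1 p.2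

/-- `(ψ, z)` is a minimizer of the quasi-classical functional. -/
def IsQcMinimizer (E : L → Z → EReal) (ψ : L) (z : Z) : Prop :=
  (ψ, z) ∈ domQc E ∧ E ψ z = energyQc E

/-- The functional `𝓕[ψ, η] = 𝓔[ψ, ω^{-1/2} η]`. -/
def fieldFunctional (E : L → Z → EReal) (T : Z ≃ₗᵢ[ℂ] 𝔥) (ψ : L) (η : 𝔥) : EReal :=
  E ψ (T.symm η)

/-- The Pekar functional `inf_{η ∈ 𝔥} 𝓕[ψ, η]`. -/
def pekar (E : L → Z → EReal) (T : Z ≃ₗᵢ[ℂ] 𝔥) (ψ : L) : EReal :=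
  ⨅ η, fieldFunctional E T ψ η

/-- The domain of the Pekar functional. -/
def domPekar (E : L → Z → EReal) (T : Z ≃ₗᵢ[ℂ] 𝔥) : Set L :=
  {ψ | ‖ψ‖ = 1 ∧ pekar E T ψ ≠ ⊤ ∧ pekar E T ψ ≠ ⊥}

/-- The Pekar ground state energy. -/
def energyPekar (E : L → Z → EReal) (T : Z ≃ₗᵢ[ℂ] 𝔥) : EReal :=
  ⨅ ψ ∈ domPekar E T, pekar E T ψ

/-- `ψ` is a minimizer of the Pekar functional. -/
def IsPekarMinimizer (E : L → Z → EReal) (T : Z ≃ₗᵢ[ℂ] 𝔥) (ψ : L) : Prop :=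
  ψ ∈ domPekar E T ∧ pekar E T ψ = energyPekar E T

/-- `𝓕[ψ, ·]` is strictly convex, and `η` is its unique minimizer and the unique solution of the
Euler-Lagrange equation `FieldEq ψ η`; that is, `η = η_Pekar[ψ]`. -/
def IsPekarField (E : L → Z → EReal) (T : Z ≃ₗᵢ[ℂ] 𝔥) (FieldEq : L → 𝔥 → Prop)
    (ψ : L) (η : 𝔥) : Prop :=
  StrictConvexOn ℝ Set.univ (fun η' => (fieldFunctional E T ψ η').toReal) ∧
  (∀ η', FieldEq ψ η' ↔ η' = η) ∧
  (∀ η', fieldFunctional E T ψ η' = pekar E T ψ ↔ η' = η)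

/-- Equivalence of the quasi-classical and the Pekar variational problems: the two ground state
energies coincide and are not `-∞`; the `ψ`-component of a quasi-classical minimizer minimizes the
Pekar functional; every `ψ` in the domain of the Pekar functional has a field `η_Pekar[ψ] ∈ 𝔥`;
and a Pekar minimizer `ψ` together with `z = ω^{-1/2} η_Pekar[ψ]` is a quasi-classical minimizer. -/
def VariationalEquivalence (E : L → Z → EReal) (T : Z ≃ₗᵢ[ℂ] 𝔥) (FieldEq : L → 𝔥 → Prop) :
    Prop :=
  (energyPekar E T = energyQc E ∧ ⊥ < energyQc E) ∧
  (∀ ψ z, IsQcMinimizer E ψ z → IsPekarMinimizer E T ψ) ∧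
  (∀ ψ ∈ domPekar E T, ∃ η, IsPekarField E T FieldEq ψ η) ∧
  (∀ ψ, IsPekarMinimizer E T ψ →
    ∃ η, IsPekarField E T FieldEq ψ η ∧ IsQcMinimizer E ψ (T.symm η))

end Variational

end

/-! For a fixed normalized `ψ` in the form domain, the energy as a function of `η = ω^{1/2} z` is
`‖η‖²` plus a convex function of `η`. Hence it lies above its tangent at any point by at least `‖δ -
η‖²` (`HasStrongGradient`), is strictly convex, and is minimized exactly at the zero of its
gradient. Finiteness of the energy restricts `ψ` only, so the infimum over pairs is an iterated
infimum and the two problems agree. `variationalEquivalence_of_gradient` carries this out. Each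
model then owes it four facts: a lower bound uniform in `ψ`, the convexity inequality, a zero of the
gradient, and the identification of that zero with the field equation.

Nelson: the interaction is `2 Re ⟨η, v⟩` with `v = ⟨ψ, Λ ψ⟩` bounded by the essential supremum of
`Λ`. The gradient is `η + v`, and completing the square bounds the energy below.

Pauli-Fierz: the kinetic term is an integral of squares of functions affine in `η`, hence convex,
and the energy is non-negative. The gradient is `η + A η + b` with `A` real-linear and positive, so
Lax-Milgram yields a zero. The gradient contains only the real part of `conj ψ · (-i∇ψ)`, whereas
the field equation contains the full product. The difference is proportional to `∇|ψ|²` paired with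
`ω^{-1/2} λ`, which vanishes in the Coulomb gauge. This is proved by approximating `ψ ∈ H¹` by
Schwartz functions, slicing in one particle variable, and moving `ω^{-1/2}` to the other side of an
inner product (`InH1.integral_current_negHalf`).

Polaron: the form factor is not square integrable, but the generated field is. It equals `√α
|k|^{-(d-1)/2}` times the conjugate Fourier transform of the particle density, which is bounded by
`1` and, since `ψ ∈ H¹`, decays like `1/|k|`. Fubini and the commutator identity turn the split
potential into `2 Re ⟨z, V⟩` with `V ∈ L²` (`InH1.polaronPotentialForm_eq`). For the lower bound, a
large auxiliary cut-off makes the high-momentum part of `‖V‖²` smaller than the kinetic energy. -/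

/-! ### Convex functionals on a complex Hilbert space -/

section Abstract

variable {𝔥 : Type*} [NormedAddCommGroup 𝔥] [InnerProductSpace ℂ 𝔥]

/-- `G` is half the gradient of the functional `f`, whose Hessian is bounded below by that of
`‖·‖²`. -/
def HasStrongGradient (f : 𝔥 → ℝ) (G : 𝔥 → 𝔥) : Prop :=
  ∀ η δ, f η + 2 * (⟪δ - η, G η⟫_ℂ).re + ‖δ - η‖ ^ 2 ≤ f δ

/-- The tangent inequality at `c = a x + b y` is tested against both endpoints. In the weighted sum
the linear terms cancel because `a (x - c) + b (y - c) = 0`, and two strictly positive squares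
remain. -/
theorem HasStrongGradient.strictConvexOn {f : 𝔥 → ℝ} {G : 𝔥 → 𝔥} (h : HasStrongGradient f G) :
    StrictConvexOn ℝ Set.univ f := by
  refine ⟨convex_univ, fun x _ y _ hxy a b ha hb hab => ?_⟩
  set c := a • x + b • y with hc
  have ex : x - c = b • (x - y) := by
    obtain rfl : a = 1 - b := by linarith
    rw [hc]; module
  have ey : y - c = -(a • (x - y)) := by
    obtain rfl : b = 1 - a := by linarith
    rw [hc]; module
  have h1 := h c x
  have h2 := h c y
  rw [ex] at h1
  rw [ey] at h2
  have i1 : (⟪b • (x - y), G c⟫_ℂ).re = b * (⟪x - y, G c⟫_ℂ).re := by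
    rw [RCLike.real_smul_eq_coe_smul (K := ℂ), inner_smul_left]; simp [inner_sub_left]
  have i2 : (⟪-(a • (x - y)), G c⟫_ℂ).re = -(a * (⟪x - y, G c⟫_ℂ).re) := by
    rw [inner_neg_left, RCLike.real_smul_eq_coe_smul (K := ℂ), inner_smul_left]; simp [inner_sub_left]
  rw [i1] at h1
  rw [i2] at h2
  have hp : 0 < ‖x - y‖ := norm_pos_iff.2 (sub_ne_zero.2 hxy)
  have n1 : 0 < ‖b • (x - y)‖ ^ 2 := by rw [norm_smul, Real.norm_of_nonneg hb.le]; positivity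
  have n2 : 0 < ‖-(a • (x - y))‖ ^ 2 := by
    rw [norm_neg, norm_smul, Real.norm_of_nonneg ha.le]; positivity
  have e1 := mul_le_mul_of_nonneg_left h1 ha.le
  have e2 := mul_le_mul_of_nonneg_left h2 hb.le
  have e3 := mul_pos ha n1
  have e4 := mul_pos hb n2
  have e5 : f c = a * f c + b * f c := by rw [← add_mul, hab, one_mul]
  simp only [smul_eq_mul]
  nlinarith

theorem HasStrongGradient.le {f : 𝔥 → ℝ} {G : 𝔥 → 𝔥} (h : HasStrongGradient f G) {η : 𝔥}
    (hη : G η = 0) (δ : 𝔥) : f η + ‖δ - η‖ ^ 2 ≤ f δ := by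
  simpa [hη] using h η δ

theorem HasStrongGradient.eq_of_eq {f : 𝔥 → ℝ} {G : 𝔥 → 𝔥} (h : HasStrongGradient f G) {η : 𝔥}
    (hη : G η = 0) {δ : 𝔥} (hδ : f δ ≤ f η) : δ = η := by
  have h1 := h.le hη δ
  have h2 : ‖δ - η‖ = 0 := by nlinarith [norm_nonneg (δ - η)]
  exact sub_eq_zero.1 (norm_eq_zero.1 h2)

theorem HasStrongGradient.eq_of_zero {f : 𝔥 → ℝ} {G : 𝔥 → 𝔥} (h : HasStrongGradient f G)
    {η δ : 𝔥} (hη : G η = 0) (hδ : G δ = 0) : δ = η :=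
  h.eq_of_eq hη (by nlinarith [h.le hδ η, sq_nonneg ‖η - δ‖])

/-- Expanding `‖η + (δ - η)‖²` shows that the required inequality is here an equality. -/
theorem hasStrongGradient_linear (c : ℝ) (v : 𝔥) :
    HasStrongGradient (fun η => c + 2 * (⟪η, v⟫_ℂ).re + ‖η‖ ^ 2) (fun η => η + v) := by
  intro η δ
  have h := norm_add_sq (𝕜 := ℂ) η (δ - η)
  rw [add_sub_cancel] at h
  simp only [RCLike.re_to_complex] at h
  have h2 : (⟪δ - η, η⟫_ℂ).re = (⟪η, δ - η⟫_ℂ).re := inner_re_symm (𝕜 := ℂ) _ _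
  simp only [inner_add_right, inner_sub_left, Complex.add_re, Complex.sub_re] at h2 ⊢
  linarith

/-- Completing the square: the difference of the two sides is `‖η + v‖²`. -/
theorem linear_field_lower_bound (v η : 𝔥) : -‖v‖ ^ 2 ≤ 2 * (⟪η, v⟫_ℂ).re + ‖η‖ ^ 2 := by
  have h := norm_add_sq (𝕜 := ℂ) η v
  simp only [RCLike.re_to_complex] at h
  nlinarith [sq_nonneg ‖η + v‖]

/-- Lax-Milgram for the real bilinear form `Re ⟨x + A x, y⟩`, which is coercive with constant `1`
because `A` is monotone. The real structure is needed because `η ↦ Re ⟨η, ξ⟩ ξ`, the operator of the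
application, is not complex linear. -/
theorem exists_zero_of_monotone [CompleteSpace 𝔥] (A : 𝔥 →L[ℝ] 𝔥)
    (hA : ∀ x, 0 ≤ (⟪x, A x⟫_ℂ).re) (b : 𝔥) : ∃ η, η + A η + b = 0 := by
  let : InnerProductSpace ℝ 𝔥 := InnerProductSpace.complexToReal
  let B : 𝔥 →L[ℝ] 𝔥 →L[ℝ] ℝ := (innerSL ℝ).comp (ContinuousLinearMap.id ℝ 𝔥 + A)
  have hB : ∀ x y, B x y = (⟪x + A x, y⟫_ℂ).re := fun x y => rfl
  have hc : IsCoercive B := by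
    refine ⟨1, one_pos, fun u => ?_⟩
    have h1 : (⟪u, u⟫_ℂ).re = ‖u‖ ^ 2 := (norm_sq_eq_re_inner (𝕜 := ℂ) u).symm
    have h2 : (⟪A u, u⟫_ℂ).re = (⟪u, A u⟫_ℂ).re := inner_re_symm (𝕜 := ℂ) _ _
    rw [hB, inner_add_left, Complex.add_re, h1, h2]
    nlinarith [hA u]
  obtain ⟨η, hη⟩ := hc.continuousLinearEquivOfBilin.surjective (-b)
  refine ⟨η, ?_⟩
  have h3 : -b = η + A η := by
    rw [← hη]
    exact (hc.unique_continuousLinearEquivOfBilin (v := η) (f := η + A η) fun w => rfl).symm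
  rw [← h3]; simp

end Abstract

/-! ### From a strong gradient to the equivalence of the variational problems -/

section Variational

variable {L Z 𝔥 : Type*} [NormedAddCommGroup L] [NormedAddCommGroup Z] [InnerProductSpace ℂ Z]
  [NormedAddCommGroup 𝔥] [InnerProductSpace ℂ 𝔥]

/-- The two variational problems are equivalent as soon as the energy, on its domain `D`, is bounded
below and, as a function of the field, has a strong gradient, whose zeros are the solutions of the
field equation and which has a zero. -/
theorem variationalEquivalence_of_gradient {E : L → Z → EReal} {T : Z ≃ₗᵢ[ℂ] 𝔥}
    {FieldEq : L → 𝔥 → Prop} (D : Set L) (f : L → 𝔥 → ℝ) (G : L → 𝔥 → 𝔥) (C : ℝ)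
    (hD : ∀ ψ ∉ D, ∀ z, E ψ z = ⊤)
    (hf : ∀ ψ ∈ D, ‖ψ‖ = 1 → ∀ η, E ψ (T.symm η) = f ψ η)
    (hC : ∀ ψ ∈ D, ‖ψ‖ = 1 → ∀ η, C ≤ f ψ η)
    (hG : ∀ ψ ∈ D, ‖ψ‖ = 1 → HasStrongGradient (f ψ) (G ψ))
    (hF : ∀ ψ ∈ D, ‖ψ‖ = 1 → ∀ η, FieldEq ψ η ↔ G ψ η = 0)
    (hz : ∀ ψ ∈ D, ‖ψ‖ = 1 → ∃ η, G ψ η = 0) :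
    VariationalEquivalence E T FieldEq := by
  have hE : ∀ ψ ∈ D, ‖ψ‖ = 1 → ∀ z, E ψ z = f ψ (T z) := fun ψ h1 h2 z => by
    rw [← hf ψ h1 h2, T.symm_apply_apply]
  -- The energy is real for every field once `ψ ∈ D`, so the domain is a product: only `ψ` is
  -- constrained. The same description holds for the Pekar domain in `hpk`.
  have hqc : ∀ ψ z, (ψ, z) ∈ domQc E ↔ ψ ∈ D ∧ ‖ψ‖ = 1 := by
    intro ψ z
    constructor
    · rintro ⟨h1, h2, -⟩
      refine ⟨?_, h1⟩
      by_contra h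
      exact h2 (hD ψ h z)
    · rintro ⟨h1, h2⟩
      refine ⟨h2, ?_, ?_⟩ <;> simp [hE ψ h1 h2]
  have hmin : ∀ ψ ∈ D, ‖ψ‖ = 1 → ∀ η, G ψ η = 0 → pekar E T ψ = f ψ η := by
    intro ψ h1 h2 η hη
    refine le_antisymm ?_ (le_iInf fun δ => ?_)
    · exact (iInf_le _ η).trans (hf ψ h1 h2 η).le
    · change _ ≤ E ψ (T.symm δ)
      rw [hf ψ h1 h2, EReal.coe_le_coe_iff]
      nlinarith [(hG ψ h1 h2).le hη δ, sq_nonneg ‖δ - η‖]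
  have hpk : ∀ ψ, ψ ∈ domPekar E T ↔ ψ ∈ D ∧ ‖ψ‖ = 1 := by
    intro ψ
    constructor
    · rintro ⟨h1, h2, -⟩
      refine ⟨?_, h1⟩
      by_contra h
      exact h2 (iInf_eq_top.2 fun δ => hD ψ h _)
    · rintro ⟨h1, h2⟩
      obtain ⟨η, hη⟩ := hz ψ h1 h2
      refine ⟨h2, ?_, ?_⟩ <;> simp [hmin ψ h1 h2 η hη]
  have hfield : ∀ ψ ∈ D, ‖ψ‖ = 1 → ∀ η, G ψ η = 0 → IsPekarField E T FieldEq ψ η := by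
    intro ψ h1 h2 η hη
    refine ⟨?_, fun δ => ?_, fun δ => ?_⟩
    · have : (fun η' => (fieldFunctional E T ψ η').toReal) = f ψ := by
        funext δ
        simp [fieldFunctional, hf ψ h1 h2]
      rw [this]
      exact (hG ψ h1 h2).strictConvexOn
    · rw [hF ψ h1 h2]
      exact ⟨(hG ψ h1 h2).eq_of_zero hη, fun h => h ▸ hη⟩
    · rw [hmin ψ h1 h2 η hη, fieldFunctional, hf ψ h1 h2, EReal.coe_eq_coe_iff]
      exact ⟨fun h => (hG ψ h1 h2).eq_of_eq hη h.le, fun h => h ▸ rfl⟩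
  -- An infimum over a product set is an iterated infimum, taken over the same pairs after the
  -- bijection `T` of the fields.
  have hen : energyPekar E T = energyQc E := by
    refine le_antisymm ?_ ?_
    · refine le_iInf₂ fun p hp => ?_
      obtain ⟨h1, h2⟩ := (hqc p.1 p.2).1 hp
      refine (iInf₂_le p.1 ((hpk _).2 ⟨h1, h2⟩)).trans ((iInf_le _ (T p.2)).trans ?_)
      rw [fieldFunctional, T.symm_apply_apply]
    · refine le_iInf₂ fun ψ hψ => le_iInf fun η => ?_
      exact iInf₂_le (ψ, T.symm η) ((hqc _ _).2 ((hpk ψ).1 hψ))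
  refine ⟨⟨hen, ?_⟩, ?_, ?_, ?_⟩
  · refine lt_of_lt_of_le (EReal.bot_lt_coe C) (le_iInf₂ fun p hp => ?_)
    obtain ⟨h1, h2⟩ := (hqc p.1 p.2).1 hp
    rw [hE _ h1 h2, EReal.coe_le_coe_iff]
    exact hC _ h1 h2 _
  · rintro ψ z ⟨h1, h2⟩
    have hψ := (hpk ψ).2 ((hqc ψ z).1 h1)
    refine ⟨hψ, le_antisymm ?_ (iInf₂_le ψ hψ)⟩
    rw [hen, ← h2]
    refine (iInf_le _ (T z)).trans ?_
    rw [fieldFunctional, T.symm_apply_apply]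
  · intro ψ hψ
    obtain ⟨h1, h2⟩ := (hpk ψ).1 hψ
    obtain ⟨η, hη⟩ := hz ψ h1 h2
    exact ⟨η, hfield ψ h1 h2 η hη⟩
  · rintro ψ ⟨hψ, hm⟩
    obtain ⟨h1, h2⟩ := (hpk ψ).1 hψ
    obtain ⟨η, hη⟩ := hz ψ h1 h2
    refine ⟨η, hfield ψ h1 h2 η hη, (hqc _ _).2 ⟨h1, h2⟩, ?_⟩
    rw [← hen, ← hm, hmin ψ h1 h2 η hη, hf ψ h1 h2]

end Variational

/-! ### Configuration space as a product -/

section Geometry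

variable {d N : ℕ}

/-- The coordinates of all particles but the `j`-th one. -/
abbrev Others (d : ℕ) {N : ℕ} (j : Fin N) : Type := {i : Fin N × Fin d // ¬ i.1 = j} → ℝ

/-- The configuration with the `j`-th particle at `x` and the other coordinates `y`. -/
def assemble (j : Fin N) (p : Position d × Others d j) : Config d N :=
  WithLp.toLp 2 fun i => if h : i.1 = j then p.1 i.2 else p.2 ⟨i, h⟩

/-- The coordinates of the `j`-th particle among all coordinates. -/
def particleCoord (d : ℕ) (j : Fin N) : Fin d ≃ {i : Fin N × Fin d // i.1 = j} where
  toFun ℓ := ⟨(j, ℓ), rfl⟩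
  invFun i := i.1.2
  left_inv _ := rfl
  right_inv := by rintro ⟨⟨i, ℓ⟩, rfl⟩; rfl

/-- A composition of relabelling coordinates, gluing two blocks of coordinates and passing between
the product and Euclidean structures, all of which preserve Lebesgue measure. It gives Fubini with
respect to a single particle. -/
theorem measurePreserving_assemble (j : Fin N) :
    MeasurePreserving (assemble (d := d) j) := by
  have h1 : MeasurePreserving (fun x : Position d =>
      (fun i => x i.1.2 : {i : Fin N × Fin d // i.1 = j} → ℝ)) := by
    have h0 := (volume_measurePreserving_piCongrLeft (fun _ => ℝ) (particleCoord d j)).comp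
      (PiLp.volume_preserving_ofLp (Fin d))
    have e : (fun x : Position d => (fun i => x i.1.2 : {i : Fin N × Fin d // i.1 = j} → ℝ)) =
        ⇑(MeasurableEquiv.piCongrLeft (fun _ => ℝ) (particleCoord d j)) ∘ WithLp.ofLp := by
      funext x i
      obtain ⟨ℓ, rfl⟩ := (particleCoord d j).surjective i
      exact (MeasurableEquiv.piCongrLeft_apply_apply (β := fun _ => ℝ)
        (particleCoord d j) x.ofLp ℓ).symm
    rw [e]
    exact h0
  have h2 := (volume_preserving_piEquivPiSubtypeProd (fun _ : Fin N × Fin d => ℝ)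
    (fun i => i.1 = j)).symm
  have h3 := (PiLp.volume_preserving_toLp (Fin N × Fin d)).comp
    (h2.comp (h1.prod (MeasurePreserving.id (volume : Measure (Others d j)))))
  exact h3

theorem particle_assemble (j : Fin N) (p : Position d × Others d j) :
    particle j (assemble j p) = p.1 := by
  ext ℓ
  simp [particle, assemble]

/-- The displacement of the `j`-th particle. -/
noncomputable def displace (j : Fin N) : Position d →L[ℝ] Config d N :=
  LinearMap.toContinuousLinearMap
    { toFun := fun x => assemble j (x, 0)
      map_add' := fun x x' => by
        ext i
        by_cases h : i.1 = j <;> simp [assemble, h]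
      map_smul' := fun t x => by
        ext i
        by_cases h : i.1 = j <;> simp [assemble, h] }

theorem assemble_eq_displace_add (j : Fin N) (x : Position d) (y : Others d j) :
    assemble j (x, y) = displace j x + assemble j (0, y) := by
  ext i
  by_cases h : i.1 = j <;> simp [displace, assemble, h]

theorem displace_single (j : Fin N) (ℓ : Fin d) :
    displace j (EuclideanSpace.single ℓ 1) = EuclideanSpace.single (j, ℓ) (1 : ℝ) := by
  ext ⟨i, m⟩
  by_cases h : i = j
  · simp [displace, assemble, h, PiLp.single_apply]
  · simp [displace, assemble, h, PiLp.single_apply]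

theorem measurableEmbedding_assemble (j : Fin N) :
    MeasurableEmbedding (assemble (d := d) j) := by
  let g : Config d N → Position d × Others d j := fun X => (particle j X, fun i => X i.1)
  have hg : Measurable g := by
    unfold g particle
    fun_prop
  have hl : Function.LeftInverse (assemble j) g := by
    intro X
    ext ⟨i, m⟩
    by_cases h : i = j
    · subst h; simp [assemble, g, particle]
    · simp [assemble, g, h]
  have hr : Function.RightInverse (assemble j) g := by
    rintro ⟨x, y⟩
    refine Prod.ext (particle_assemble j _) ?_
    funext i
    simp [assemble, g, i.2]
  exact (MeasurableEquiv.measurableEmbedding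
    ⟨⟨assemble j, g, hr, hl⟩, (measurePreserving_assemble j).measurable, hg⟩)

theorem measurable_particle (j : Fin N) : Measurable (particle (d := d) j) := by
  unfold particle
  fun_prop

theorem continuous_particle (j : Fin N) : Continuous (particle (d := d) j) := by
  unfold particle
  fun_prop

/-- In the product coordinates of `assemble` the map is the first projection, so null sets of `ℝ^d`
pull back to null sets. This transports almost-everywhere bounds on form factors to configuration
space. -/
theorem quasiMeasurePreserving_particle (j : Fin N) :
    Measure.QuasiMeasurePreserving (particle (d := d) j) := by
  refine ⟨measurable_particle j, ?_⟩
  rw [← (measurePreserving_assemble (d := d) j).map_eq,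
    Measure.map_map (measurable_particle j) (measurePreserving_assemble j).measurable]
  have : particle j ∘ assemble j = (Prod.fst : Position d × Others d j → Position d) :=
    funext fun p => particle_assemble j p
  rw [this]
  exact Measure.quasiMeasurePreserving_fst.absolutelyContinuous

end Geometry

/-! ### Bounded functions -/

section Bounded

variable {α β F : Type*} [MeasurableSpace α] [MeasurableSpace β] {μ : Measure α} {ν : Measure β}
  [NormedAddCommGroup F]

theorem exists_ae_bound {f : α → F} (hf : MemLp f ⊤ μ) : ∃ C, 0 ≤ C ∧ ∀ᵐ x ∂μ, ‖f x‖ ≤ C := by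
  refine ⟨(eLpNormEssSup f μ).toReal, ENNReal.toReal_nonneg, ?_⟩
  have h : eLpNormEssSup f μ < ⊤ := by simpa using hf.2
  filter_upwards [ae_le_eLpNormEssSup (f := f) (μ := μ)] with x hx
  rw [← toReal_enorm]
  exact ENNReal.toReal_mono h.ne hx

theorem memLp_top_comp {f : β → F} (hf : MemLp f ⊤ ν) {g : α → β}
    (hg : Measure.QuasiMeasurePreserving g μ ν) : MemLp (fun x => f (g x)) ⊤ μ := by
  obtain ⟨C, -, hC⟩ := exists_ae_bound hf
  exact memLp_top_of_bound (hf.1.comp_quasiMeasurePreserving hg) C (hg.ae hC)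

theorem integrable_norm_sq (ψ : Lp F 2 μ) : Integrable (fun x => ‖ψ x‖ ^ 2) μ :=
  (Lp.memLp ψ).integrable_norm_pow (p := 2) (by norm_num)

theorem integral_norm_sq (ψ : Lp ℂ 2 μ) : ∫ x, ‖ψ x‖ ^ 2 ∂μ = ‖ψ‖ ^ 2 := by
  have h := L2.inner_def (𝕜 := ℂ) ψ ψ
  rw [inner_self_eq_norm_sq_to_K] at h
  have e : (fun x => ⟪ψ x, ψ x⟫_ℂ) = fun x => ((‖ψ x‖ ^ 2 : ℝ) : ℂ) := by
    funext x
    rw [inner_self_eq_norm_sq_to_K]; simp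
  rw [e, integral_complex_ofReal] at h
  have h2 : ((‖ψ‖ ^ 2 : ℝ) : ℂ) = ((∫ x, ‖ψ x‖ ^ 2 ∂μ : ℝ) : ℂ) := by
    rw [← h]; simp
  exact (Complex.ofReal_injective h2).symm

theorem integrable_conj_mul (φ ψ : Lp ℂ 2 μ) :
    Integrable (fun x => starRingEnd ℂ (φ x) * ψ x) μ := by
  have h := L2.integrable_inner (𝕜 := ℂ) φ ψ
  refine h.congr (Filter.Eventually.of_forall fun x => ?_)
  simp [mul_comm]

theorem integrable_conj_mul_mul (φ ψ : Lp ℂ 2 μ) {h : α → ℂ} (hh : MemLp h ⊤ μ) :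
    Integrable (fun x => starRingEnd ℂ (φ x) * ψ x * h x) μ := by
  exact (integrable_conj_mul φ ψ).smul_of_top_left hh

theorem integral_conj_mul_mul_eq_inner (φ ψ : Lp ℂ 2 μ) {h : α → ℂ} (hh : MemLp h ⊤ μ) :
    ∫ x, starRingEnd ℂ (φ x) * ψ x * h x ∂μ = ⟪φ, (hh.toLp h) • ψ⟫_ℂ := by
  rw [L2.inner_def]
  refine integral_congr_ae ?_
  filter_upwards [Lp.coeFn_lpSMul (r := 2) (hh.toLp h) ψ, hh.coeFn_toLp] with x hx hx2
  rw [hx, Pi.smul_apply', hx2]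
  simp only [smul_eq_mul, RCLike.inner_apply]
  ring

-- Multiplication by a bounded function is continuous on `L²`, so the integral is an inner product
-- of two convergent sequences. This is how identities pass from Schwartz functions to `H¹`.
open Filter Topology in
theorem tendsto_integral_conj_mul_mul {h : α → ℂ} (hh : MemLp h ⊤ μ) {φ ψ : Lp ℂ 2 μ}
    {φn ψn : ℕ → Lp ℂ 2 μ} (hφ : Tendsto φn atTop (𝓝 φ)) (hψ : Tendsto ψn atTop (𝓝 ψ)) :
    Tendsto (fun n => ∫ x, starRingEnd ℂ (φn n x) * ψn n x * h x ∂μ) atTop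
      (𝓝 (∫ x, starRingEnd ℂ (φ x) * ψ x * h x ∂μ)) := by
  simp only [integral_conj_mul_mul_eq_inner _ _ hh]
  refine hφ.inner ?_
  have hc : Continuous fun ψ : Lp ℂ 2 μ => (((hh.toLp h) • ψ : Lp ℂ 2 μ)) :=
    (((ContinuousLinearMap.lsmul ℂ ℂ).holderL μ ⊤ 2 2) (hh.toLp h)).continuous
  exact (hc.tendsto ψ).comp hψ

end Bounded

/-! ### The Nelson model -/

theorem kinetic_le_freeForm {d N : ℕ} {W : Config d N → ℝ} (hW : IsPotential W) (ψ : Wave d N) :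
    (∑ j, ∑ ℓ, ‖momentum ψ j ℓ‖ ^ 2) ≤ freeForm W ψ := by
  have : 0 ≤ ∫ X, W X * ‖ψ X‖ ^ 2 := by
    refine integral_nonneg_of_ae ?_
    filter_upwards [hW.2] with X hX
    positivity
  unfold freeForm
  linarith

section Nelson

variable {𝔥 : Type*} [NormedAddCommGroup 𝔥] [InnerProductSpace ℂ 𝔥] [CompleteSpace 𝔥]

theorem Dispersion.pairing_symm (ω : Dispersion 𝔥) (η v : 𝔥) :
    ω.pairing (ω.halfIso.symm η) v = ⟪η, ω.negHalfApply v⟫_ℂ := by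
  rw [Dispersion.pairing, LinearIsometryEquiv.apply_symm_apply]

theorem memLp_top_particle {d N : ℕ} {F : Type*} [NormedAddCommGroup F] {ξ : Position d → F}
    (hξ : MemLp ξ ⊤) (j : Fin N) : MemLp (fun X : Config d N => ξ (particle j X)) ⊤ :=
  memLp_top_comp hξ (quasiMeasurePreserving_particle j)

/-- The interaction energy is the real part of an inner product with the Bochner integral `v ψ`, so
the functional is a quadratic polynomial in `η` with half gradient `η + v ψ`. -/
theorem nelson_variationalEquivalence (ω : Dispersion 𝔥) {d N : ℕ} {W : Config d N → ℝ}
    (hW : IsPotential W) {lam : Position d → 𝔥} (hl : IsFormFactor ω lam) :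
    VariationalEquivalence (nelsonEnergy ω lam W) ω.halfIso (nelsonFieldEq ω lam) := by
  set Λ : Config d N → 𝔥 := fun X => ∑ j, ω.negHalfApply (lam (particle j X)) with hΛ
  have hΛm : MemLp Λ ⊤ :=
    memLp_finsetSum _ fun j _ => memLp_top_particle hl.2.2 j
  obtain ⟨K, hK0, hK⟩ := exists_ae_bound hΛm
  have hint : ∀ ψ : Wave d N, Integrable fun X => (‖ψ X‖ ^ 2) • Λ X := fun ψ =>
    (integrable_norm_sq ψ).smul_of_top_left hΛm
  let v : Wave d N → 𝔥 := fun ψ => ∫ X, (‖ψ X‖ ^ 2) • Λ X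
  have hv : ∀ ψ : Wave d N, ‖ψ‖ = 1 → ‖v ψ‖ ≤ K := by
    intro ψ hψ
    calc ‖v ψ‖ ≤ ∫ X, ‖ψ X‖ ^ 2 * K := by
          refine norm_integral_le_of_norm_le ((integrable_norm_sq ψ).mul_const K) ?_
          filter_upwards [hK] with X hX
          rw [norm_smul, Real.norm_of_nonneg (by positivity)]
          gcongr
      _ = K := by rw [integral_mul_const, integral_norm_sq, hψ]; simp
  -- The lower bound `-K ^ 2` comes from completing the square, with `‖v ψ‖ ≤ K` for normalized `ψ`
  -- and a non-negative free form.
  refine variationalEquivalence_of_gradient (formDomain W)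
    (fun ψ η => freeForm W ψ + 2 * (⟪η, v ψ⟫_ℂ).re + ‖η‖ ^ 2) (fun ψ η => η + v ψ) (-K ^ 2)
    ?_ ?_ ?_ ?_ ?_ ?_
  · intro ψ hψ z
    simp [nelsonEnergy, hψ]
  · intro ψ hψ h1 η
    have e : ∫ X, (∑ j, 2 * (ω.pairing (ω.halfIso.symm η) (lam (particle j X))).re) * ‖ψ X‖ ^ 2
        = 2 * (⟪η, v ψ⟫_ℂ).re := by
      rw [← integral_inner (hint ψ) η]
      have h2 := integral_re (𝕜 := ℂ) ((hint ψ).const_inner (𝕜 := ℂ) η)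
      simp only [RCLike.re_to_complex] at h2
      rw [← h2, ← integral_const_mul]
      refine integral_congr_ae (Filter.Eventually.of_forall fun X => ?_)
      simp only [ω.pairing_symm, hΛ]
      rw [RCLike.real_smul_eq_coe_smul (K := ℂ), inner_smul_right, inner_sum]
      simp only [Complex.coe_algebraMap, Complex.re_ofReal_mul, Complex.re_sum, ← Finset.mul_sum]
      ring
    simp only [nelsonEnergy, hψ, if_true, e, LinearIsometryEquiv.norm_map]
  · intro ψ hψ h1 η
    have h2 := linear_field_lower_bound (v ψ) η
    have h3 := (Finset.sum_nonneg fun j _ => Finset.sum_nonneg fun ℓ _ =>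
      sq_nonneg ‖momentum ψ j ℓ‖).trans (kinetic_le_freeForm hW ψ)
    have h4 := pow_le_pow_left₀ (norm_nonneg _) (hv ψ h1) 2
    linarith
  · intro ψ hψ h1
    exact hasStrongGradient_linear _ _
  · intro ψ hψ h1 η
    rfl
  · intro ψ hψ h1
    exact ⟨-v ψ, by simp⟩

end Nelson

/-! ### Density of Schwartz functions in the Sobolev space of order one -/

section Sobolev

open TemperedDistribution FourierTransform Filter Topology

variable {E : Type*} [NormedAddCommGroup E] [InnerProductSpace ℝ E] [FiniteDimensional ℝ E]
  [MeasurableSpace E] [BorelSpace E]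

/-- Identities in `L²` can thus be checked among tempered distributions, where derivatives and
Fourier multipliers always act. -/
theorem toTemperedDistribution_injective {f g : Lp ℂ 2 (volume : Measure E)}
    (h : (f : 𝓢'(E, ℂ)) = (g : 𝓢'(E, ℂ))) : f = g := by
  have hk := Lp.ker_toTemperedDistributionCLM_eq_bot (F := ℂ) (μ := (volume : Measure E)) (p := 2)
  exact LinearMap.ker_eq_bot.1 hk h

/-- A Fourier multiplier with a bounded symbol of temperate growth acts boundedly on `L²`. -/
theorem exists_bounded_multiplier {g : E → ℂ} (hg : g.HasTemperateGrowth)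
    (hb : ∃ C, ∀ x, ‖g x‖ ≤ C) :
    ∃ M : Lp ℂ 2 (volume : Measure E) →L[ℂ] Lp ℂ 2 (volume : Measure E),
      (∀ f : Lp ℂ 2 (volume : Measure E),
        ((M f : Lp ℂ 2 (volume : Measure E)) : 𝓢'(E, ℂ)) =
          fourierMultiplierCLM ℂ g (f : 𝓢'(E, ℂ))) ∧
      ∀ φ : 𝓢(E, ℂ), M (φ.toLp 2) = (SchwartzMap.fourierMultiplierCLM ℂ g φ).toLp 2 := by
  obtain ⟨C, hC⟩ := hb
  have hm : MemLp g ⊤ (volume : Measure E) :=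
    memLp_top_of_bound hg.1.continuous.aestronglyMeasurable C (Filter.Eventually.of_forall hC)
  let M : Lp ℂ 2 (volume : Measure E) →L[ℂ] Lp ℂ 2 (volume : Measure E) :=
    (fourierInvCLM ℂ (Lp ℂ 2 (volume : Measure E))).comp
      ((((ContinuousLinearMap.lsmul ℂ ℂ).holderL volume ⊤ 2 2) (hm.toLp g)).comp
        (fourierCLM ℂ (Lp ℂ 2 (volume : Measure E))))
  have hM : ∀ f, M f = 𝓕⁻ ((hm.toLp g) • 𝓕 f : Lp ℂ 2 (volume : Measure E)) := fun f => rfl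
  have h1 : ∀ f : Lp ℂ 2 (volume : Measure E),
        ((M f : Lp ℂ 2 (volume : Measure E)) : 𝓢'(E, ℂ)) =
          fourierMultiplierCLM ℂ g (f : 𝓢'(E, ℂ)) := by
    intro f
    rw [hM, ← Lp.fourierInv_toTemperedDistribution_eq, fourierMultiplierCLM_apply,
      Lp.toTemperedDistribution_smul_eq hg, Lp.fourier_toTemperedDistribution_eq]
  refine ⟨M, h1, fun φ => toTemperedDistribution_injective ?_⟩
  rw [h1, Lp.toTemperedDistribution_toLp_eq, Lp.toTemperedDistribution_toLp_eq,
    fourierMultiplierCLM_toTemperedDistributionCLM_eq hg]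

/-- `ψ` is the image of some `f ∈ L²` under the multiplier `(1 + |ξ|²)^{-1/2}`. Both this multiplier
and its composition with a derivative are bounded on `L²`, so applying them to Schwartz functions
converging to `f` gives convergence of the functions and of all first derivatives along one
sequence. -/
theorem exists_schwartz_approximation {ψ : Lp ℂ 2 (volume : Measure E)}
    (hψ : MemSobolev 1 2 (ψ : 𝓢'(E, ℂ))) :
    ∃ φ : ℕ → 𝓢(E, ℂ), Tendsto (fun n => (φ n).toLp 2) atTop (𝓝 ψ) ∧
      ∀ m : E, ∃ g : Lp ℂ 2 (volume : Measure E), ∂_{m} (ψ : 𝓢'(E, ℂ)) = (g : 𝓢'(E, ℂ)) ∧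
        Tendsto (fun n => (∂_{m} (φ n)).toLp 2) atTop (𝓝 g) := by
  obtain ⟨f, hf⟩ := hψ
  let g₀ : E → ℂ := fun x => ((1 + ‖x‖ ^ 2) ^ (-1 / 2 : ℝ) : ℝ)
  have hg₀ : g₀.HasTemperateGrowth := by fun_prop
  have hb₀ : ∀ x, ‖g₀ x‖ ≤ 1 := by
    intro x
    rw [Complex.norm_real, Real.norm_of_nonneg (by positivity)]
    exact Real.rpow_le_one_of_one_le_of_nonpos (by nlinarith [sq_nonneg ‖x‖]) (by norm_num)
  have hψf : fourierMultiplierCLM ℂ g₀ (f : 𝓢'(E, ℂ)) = ψ :=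
    (besselPotential_neg_apply_eq_iff 1 _ _).2 hf
  obtain ⟨M₀, hM₀, hM₀'⟩ := exists_bounded_multiplier hg₀ ⟨1, hb₀⟩
  have hψ₀ : M₀ f = ψ := toTemperedDistribution_injective (by rw [hM₀, hψf])
  have hd := SchwartzMap.denseRange_toLpCLM (E := E) (F := ℂ) (p := 2) (by norm_num)
    (μ := (volume : Measure E))
  obtain ⟨u, hu, hlim⟩ := mem_closure_iff_seq_limit.1 (hd f)
  choose χ hχ using hu
  have hlim' : Tendsto (fun n => (χ n).toLp 2 (volume : Measure E)) atTop (𝓝 f) := by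
    convert hlim using 2 with n
    exact hχ n
  refine ⟨fun n => SchwartzMap.fourierMultiplierCLM ℂ g₀ (χ n), ?_, fun m => ?_⟩
  · simp only [← hM₀', ← hψ₀]
    exact (M₀.continuous.tendsto f).comp hlim'
  -- The symbol of `∂_m` up to the factor `2πi`. It is unbounded, but its product with `g₀` is
  -- bounded by `‖m‖` since `|x| ≤ (1 + |x|²)^{1/2}`.
  let g₁ : E → ℂ := fun x => (inner ℝ x m : ℝ)
  have hg₁ : g₁.HasTemperateGrowth := by fun_prop
  have hb₁ : ∀ x, ‖(g₀ * g₁) x‖ ≤ ‖m‖ := by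
    intro x
    have hx : 0 < 1 + ‖x‖ ^ 2 := by positivity
    have h1 : ‖g₀ x‖ * ‖x‖ ≤ 1 := by
      rw [Complex.norm_real, Real.norm_of_nonneg (by positivity), neg_div,
        Real.rpow_neg hx.le, ← Real.sqrt_eq_rpow, inv_mul_le_one₀ (Real.sqrt_pos.2 hx)]
      exact Real.le_sqrt_of_sq_le (by linarith)
    have h2 : ‖g₁ x‖ ≤ ‖x‖ * ‖m‖ := by
      rw [Complex.norm_real]
      exact norm_inner_le_norm x m
    calc ‖(g₀ * g₁) x‖ = ‖g₀ x‖ * ‖g₁ x‖ := norm_mul _ _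
      _ ≤ ‖g₀ x‖ * (‖x‖ * ‖m‖) := by gcongr
      _ = (‖g₀ x‖ * ‖x‖) * ‖m‖ := by ring
      _ ≤ 1 * ‖m‖ := by gcongr
      _ = ‖m‖ := one_mul _
  obtain ⟨M₁, hM₁, -⟩ := exists_bounded_multiplier (hg₀.mul hg₁) ⟨‖m‖, hb₁⟩
  -- The factor from the normalization of the Fourier transform with `2π` in the exponent.
  let c : ℂ := 2 * Real.pi * Complex.I
  have key : ∀ v : Lp ℂ 2 (volume : Measure E), ∂_{m} ((M₀ v : Lp ℂ 2 (volume : Measure E)) :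
      𝓢'(E, ℂ)) = ((c • M₁ v : Lp ℂ 2 (volume : Measure E)) : 𝓢'(E, ℂ)) := by
    intro v
    have h1 : ((c • M₁ v : Lp ℂ 2 (volume : Measure E)) : 𝓢'(E, ℂ)) =
        c • ((M₁ v : Lp ℂ 2 (volume : Measure E)) : 𝓢'(E, ℂ)) :=
      map_smul (Lp.toTemperedDistributionCLM ℂ (volume : Measure E) 2) c (M₁ v)
    rw [h1, hM₁, hM₀, lineDeriv_eq_fourierMultiplierCLM,
      fourierMultiplierCLM_fourierMultiplierCLM_apply hg₀ hg₁]
  refine ⟨c • M₁ f, ?_, ?_⟩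
  · rw [← hψ₀]; exact key f
  · have h2 : ∀ n, (∂_{m} (SchwartzMap.fourierMultiplierCLM ℂ g₀ (χ n))).toLp 2 =
        c • M₁ ((χ n).toLp 2 (volume : Measure E)) := by
      intro n
      refine toTemperedDistribution_injective ?_
      rw [← key, hM₀', Lp.toTemperedDistribution_toLp_eq, Lp.toTemperedDistribution_toLp_eq,
        lineDerivOp_toTemperedDistributionCLM_eq]
    simp only [h2]
    exact ((M₁.continuous.tendsto f).comp hlim').const_smul c

end Sobolev

/-! ### Momenta and densities of `H¹` functions -/

section Momentum

open Filter Topology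

variable {d N : ℕ}

/-- An `L²` weak derivative is unique, so the choice made in `momentum` is immaterial. -/
theorem momentum_eq_of_hasWeakPartial {ψ g : Wave d N} {j : Fin N} {ℓ : Fin d}
    (h : HasWeakPartial ψ j ℓ g) : momentum ψ j ℓ = (-Complex.I) • g := by
  have hex : ∃ g, HasWeakPartial ψ j ℓ g := ⟨g, h⟩
  rw [momentum, dif_pos hex]
  congr 1
  exact toTemperedDistribution_injective (hex.choose_spec.symm.trans h)

theorem InH1.exists_approximation {ψ : Wave d N} (hψ : InH1 ψ) :
    ∃ φ : ℕ → 𝓢(Config d N, ℂ), Tendsto (fun n => (φ n).toLp 2) atTop (𝓝 ψ) ∧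
      ∀ j ℓ, Tendsto (fun n =>
        (∂_{(EuclideanSpace.single (j, ℓ) (1 : ℝ) : Config d N)} (φ n)).toLp 2) atTop
          (𝓝 (Complex.I • momentum ψ j ℓ)) := by
  obtain ⟨φ, h1, h2⟩ := exists_schwartz_approximation hψ
  refine ⟨φ, h1, fun j ℓ => ?_⟩
  obtain ⟨g, hg, hlim⟩ := h2 (EuclideanSpace.single (j, ℓ) 1)
  rw [momentum_eq_of_hasWeakPartial hg, smul_smul]
  simpa using hlim

/-- An identity between the derivative of the density `|φ|²` and the density itself, tested with
bounded functions, extends from Schwartz functions to `H¹`. -/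
theorem InH1.integral_density {ψ : Wave d N} (hψ : InH1 ψ) (j : Fin N) (s : Finset (Fin d))
    {h : Fin d → Config d N → ℂ} (hh : ∀ ℓ, MemLp (h ℓ) ⊤) {b : Config d N → ℂ} (hb : MemLp b ⊤)
    (hS : ∀ φ : 𝓢(Config d N, ℂ), ∑ ℓ ∈ s, ∫ X,
      (starRingEnd ℂ (∂_{(EuclideanSpace.single (j, ℓ) (1 : ℝ) : Config d N)} φ X) * φ X
        + starRingEnd ℂ (φ X) * ∂_{(EuclideanSpace.single (j, ℓ) (1 : ℝ) : Config d N)} φ X)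
        * h ℓ X = ∫ X, starRingEnd ℂ (φ X) * φ X * b X) :
    ∑ ℓ ∈ s, ∫ X, (starRingEnd ℂ (momentum ψ j ℓ X) * ψ X
      - starRingEnd ℂ (ψ X) * momentum ψ j ℓ X) * h ℓ X =
      Complex.I * ∫ X, starRingEnd ℂ (ψ X) * ψ X * b X := by
  -- Both sides of the identity are continuous along this sequence, which converges together with
  -- its first derivatives.
  obtain ⟨φ, hφ, hD⟩ := hψ.exists_approximation
  have hlhs := tendsto_finsetSum s fun ℓ _ =>
    (tendsto_integral_conj_mul_mul (hh ℓ) (hD j ℓ) hφ).add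
      (tendsto_integral_conj_mul_mul (hh ℓ) hφ (hD j ℓ))
  have hrhs := tendsto_integral_conj_mul_mul hb hφ hφ
  have heq : ∀ n, ∑ ℓ ∈ s, ((∫ X, starRingEnd ℂ
        ((∂_{(EuclideanSpace.single (j, ℓ) (1 : ℝ) : Config d N)} (φ n)).toLp 2 volume X) *
          (φ n).toLp 2 volume X * h ℓ X)
      + ∫ X, starRingEnd ℂ ((φ n).toLp 2 volume X) *
        (∂_{(EuclideanSpace.single (j, ℓ) (1 : ℝ) : Config d N)} (φ n)).toLp 2 volume X * h ℓ X)
      = ∫ X, starRingEnd ℂ ((φ n).toLp 2 volume X) * (φ n).toLp 2 volume X * b X := by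
    intro n
    have e0 := (φ n).coeFn_toLp 2 (volume : Measure (Config d N))
    have e1 : ∫ X, starRingEnd ℂ ((φ n).toLp 2 volume X) * (φ n).toLp 2 volume X * b X
        = ∫ X, starRingEnd ℂ (φ n X) * φ n X * b X := by
      refine integral_congr_ae ?_
      filter_upwards [e0] with X hX
      rw [hX]
    rw [e1, ← hS (φ n)]
    refine Finset.sum_congr rfl fun ℓ _ => ?_
    rw [← integral_add (integrable_conj_mul_mul _ _ (hh ℓ)) (integrable_conj_mul_mul _ _ (hh ℓ))]
    refine integral_congr_ae ?_
    filter_upwards [e0, (∂_{(EuclideanSpace.single (j, ℓ) (1 : ℝ) : Config d N)}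
      (φ n)).coeFn_toLp 2 (volume : Measure (Config d N))] with X hX hX'
    rw [hX, hX']
    ring
  have hfin := tendsto_nhds_unique (hlhs.congr heq) hrhs
  rw [← hfin, Finset.mul_sum]
  refine Finset.sum_congr rfl fun ℓ _ => ?_
  rw [← integral_add (integrable_conj_mul_mul _ _ (hh ℓ)) (integrable_conj_mul_mul _ _ (hh ℓ)),
    ← integral_const_mul]
  refine integral_congr_ae ?_
  -- With `∂ψ = i p`, one has `conj(∂ψ) ψ + conj(ψ) ∂ψ = -i (conj(p) ψ - conj(ψ) p)`, which accounts
  -- for the factor `i` on the right.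
  filter_upwards [Lp.coeFn_smul Complex.I (momentum ψ j ℓ)] with X hX
  rw [hX]
  simp only [Pi.smul_apply, smul_eq_mul, map_mul, Complex.conj_I]
  linear_combination (starRingEnd ℂ (momentum ψ j ℓ X) * ψ X * h ℓ X
    - starRingEnd ℂ (ψ X) * momentum ψ j ℓ X * h ℓ X) * Complex.I_sq

end Momentum

/-! ### Divergence-free fields tested with densities in configuration space -/

section Divergence

open Filter Topology

variable {N : ℕ}

/-- With the other particles frozen, `ρ` is a test function of `x_j` whose gradient consists of the
partial derivatives of `ρ` in the coordinates of particle `j`. The inner integral of Fubini vanishes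
by the weak divergence condition. -/
theorem integral_divergence_compact {d : ℕ} {h : Fin d → Position d → ℂ} (hh : ∀ ℓ, MemLp (h ℓ) ⊤)
    (hdiv : ∀ φ : Position d → ℝ, ContDiff ℝ ((⊤ : ℕ∞) : WithTop ℕ∞) φ → HasCompactSupport φ →
      ∫ x, ∑ ℓ, (fderiv ℝ φ x (EuclideanSpace.single ℓ 1)) • h ℓ x = 0)
    (j : Fin N) {ρ : Config d N → ℝ} (hρ : ContDiff ℝ ((⊤ : ℕ∞) : WithTop ℕ∞) ρ)
    (hc : HasCompactSupport ρ) :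
    ∫ X, ∑ ℓ, (fderiv ℝ ρ X (EuclideanSpace.single (j, ℓ) 1)) • h ℓ (particle j X) = 0 := by
  have hint : Integrable fun X =>
      ∑ ℓ, (fderiv ℝ ρ X (EuclideanSpace.single (j, ℓ) 1)) • h ℓ (particle j X) := by
    refine integrable_finsetSum _ fun ℓ _ => ?_
    have h1 : Integrable fun X => fderiv ℝ ρ X (EuclideanSpace.single (j, ℓ) 1) := by
      refine Continuous.integrable_of_hasCompactSupport ?_ ?_
      · exact (hρ.continuous_fderiv (by simp)).clm_apply continuous_const
      · exact (hc.fderiv ℝ).comp_left (g := fun L : Config d N →L[ℝ] ℝ =>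
          L (EuclideanSpace.single (j, ℓ) 1)) rfl
    exact h1.smul_of_top_left (memLp_top_particle (hh ℓ) j)
  have hmp := measurePreserving_assemble (d := d) j
  have hemb := measurableEmbedding_assemble (d := d) j
  rw [← hmp.integral_comp hemb]
  have hint' := (hmp.integrable_comp_emb hemb).2 hint
  refine (integral_prod_symm _ hint').trans ?_
  refine integral_eq_zero_of_ae (Eventually.of_forall fun y => ?_)
  set ρy : Position d → ℝ := fun x => ρ (assemble j (x, y)) with hρy
  have hslice : ∀ x, HasFDerivAt (fun x => assemble j (x, y)) (displace (d := d) j) x := by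
    intro x
    have : (fun x => assemble j (x, y)) = fun x => displace j x + assemble j (0, y) :=
      funext fun x => assemble_eq_displace_add j x y
    rw [this]
    exact (displace j).hasFDerivAt.add_const _
  have hcont : ContDiff ℝ ((⊤ : ℕ∞) : WithTop ℕ∞) (fun x : Position d => assemble j (x, y)) := by
    have : (fun x => assemble j (x, y)) = fun x => displace j x + assemble j (0, y) :=
      funext fun x => assemble_eq_displace_add j x y
    rw [this]
    exact (displace j).contDiff.add contDiff_const
  -- A slice inherits compact support because the slice map has a continuous left inverse and is
  -- therefore a closed embedding.
  have hcl : IsClosedEmbedding (fun x : Position d => assemble j (x, y)) :=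
    Function.LeftInverse.isClosedEmbedding (f := particle j)
      (fun x => particle_assemble j (x, y)) (continuous_particle j) hcont.continuous
  have h0 := hdiv ρy (hρ.comp hcont) (hc.comp_isClosedEmbedding hcl)
  change ∫ x, _ = 0
  rw [← h0]
  refine integral_congr_ae (Eventually.of_forall fun x => ?_)
  refine Finset.sum_congr rfl fun ℓ _ => ?_
  have hd : HasFDerivAt ρy ((fderiv ℝ ρ (assemble j (x, y))).comp (displace j)) x :=
    ((hρ.differentiable (by simp)) _).hasFDerivAt.comp x (hslice x)
  rw [hd.fderiv, particle_assemble, ContinuousLinearMap.comp_apply, displace_single]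

/-- The density is cut off by `χ(t_n X)` with `t_n → 0`. The derivative of the cut-off carries a
factor `t_n` and disappears in the limit, by dominated convergence. -/
theorem integral_divergence_integrable {d : ℕ} {h : Fin d → Position d → ℂ}
    (hh : ∀ ℓ, MemLp (h ℓ) ⊤)
    (hdiv : ∀ φ : Position d → ℝ, ContDiff ℝ ((⊤ : ℕ∞) : WithTop ℕ∞) φ → HasCompactSupport φ →
      ∫ x, ∑ ℓ, (fderiv ℝ φ x (EuclideanSpace.single ℓ 1)) • h ℓ x = 0)
    (j : Fin N) {ρ : Config d N → ℝ} (hρ : ContDiff ℝ ((⊤ : ℕ∞) : WithTop ℕ∞) ρ)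
    (hi : Integrable ρ)
    (hi' : ∀ ℓ, Integrable fun X => fderiv ℝ ρ X (EuclideanSpace.single (j, ℓ) 1)) :
    ∫ X, ∑ ℓ, (fderiv ℝ ρ X (EuclideanSpace.single (j, ℓ) 1)) • h ℓ (particle j X) = 0 := by
  let χ : ContDiffBump (0 : Config d N) := ⟨1, 2, one_pos, one_lt_two⟩
  have hχ : ContDiff ℝ ((⊤ : ℕ∞) : WithTop ℕ∞) χ := χ.contDiff
  obtain ⟨K, hK⟩ := (hχ.continuous_fderiv (by simp)).bounded_above_of_compact_support
    (χ.hasCompactSupport.fderiv ℝ)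
  let t : ℕ → ℝ := fun n => 1 / ((n : ℝ) + 1)
  have ht0 : ∀ n, 0 < t n := fun n => by positivity
  have ht1 : ∀ n, t n ≤ 1 := fun n => by
    rw [div_le_one (by positivity)]; linarith [Nat.cast_nonneg (α := ℝ) n]
  have htl : Tendsto t atTop (𝓝 0) := tendsto_one_div_add_atTop_nhds_zero_nat
  let c : ℕ → Config d N → ℝ := fun n X => χ (t n • X)
  have hcd : ∀ n X, HasFDerivAt (c n) (t n • fderiv ℝ χ (t n • X)) X := by
    intro n X
    have h1 := ((hχ.differentiable (by simp)) (t n • X)).hasFDerivAt.comp X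
      ((hasFDerivAt_id X).const_smul (t n))
    have e : t n • fderiv ℝ χ (t n • X) =
        (fderiv ℝ χ (t n • X)).comp (t n • ContinuousLinearMap.id ℝ (Config d N)) := by
      ext v
      simp
    rw [e]
    exact h1
  have hcs : ∀ n, ContDiff ℝ ((⊤ : ℕ∞) : WithTop ℕ∞) (c n) := fun n =>
    hχ.comp (contDiff_const_smul (t n))
  have hcc : ∀ n, HasCompactSupport (c n) := fun n =>
    χ.hasCompactSupport.comp_smul (ht0 n).ne'
  have hzero : ∀ n, ∫ X, ∑ ℓ, (fderiv ℝ (fun X => c n X * ρ X) X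
      (EuclideanSpace.single (j, ℓ) 1)) • h ℓ (particle j X) = 0 := fun n =>
    integral_divergence_compact hh hdiv j ((hcs n).mul hρ) ((hcc n).mul_right)
  have hder : ∀ n X (v : Config d N), fderiv ℝ (fun X => c n X * ρ X) X v =
      c n X * fderiv ℝ ρ X v + ρ X * (t n * fderiv ℝ χ (t n • X) v) := by
    intro n X v
    have h1 := (hcd n X).mul ((hρ.differentiable (by simp)) X).hasFDerivAt
    have h2 : HasFDerivAt (fun X => c n X * ρ X) _ X := h1
    rw [h2.fderiv]
    simp
  choose B hB0 hB using fun ℓ => exists_ae_bound (memLp_top_particle (N := N) (hh ℓ) j)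
  have hlim : Tendsto (fun n => ∫ X, ∑ ℓ, (fderiv ℝ (fun X => c n X * ρ X) X
      (EuclideanSpace.single (j, ℓ) 1)) • h ℓ (particle j X)) atTop
      (𝓝 (∫ X, ∑ ℓ, (fderiv ℝ ρ X (EuclideanSpace.single (j, ℓ) 1)) • h ℓ (particle j X))) := by
    -- The majorant uses `0 ≤ χ ≤ 1`, `t_n ≤ 1`, the bound `K` on the derivative of `χ` and the
    -- essential bounds `B ℓ` on the field.
    refine tendsto_integral_of_dominated_convergence
      (fun X => ∑ ℓ, (‖fderiv ℝ ρ X (EuclideanSpace.single (j, ℓ) 1)‖ + ‖ρ X‖ * K) * B ℓ)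
      ?_ ?_ ?_ ?_
    · intro n
      refine Finset.aestronglyMeasurable_fun_sum _ fun ℓ _ => ?_
      have h1 : Continuous fun X => fderiv ℝ (fun X => c n X * ρ X) X
          (EuclideanSpace.single (j, ℓ) 1) :=
        (((hcs n).mul hρ).continuous_fderiv (by simp)).clm_apply continuous_const
      exact h1.aestronglyMeasurable.smul (memLp_top_particle (hh ℓ) j).1
    · exact integrable_finsetSum _ fun ℓ _ =>
        ((hi' ℓ).norm.add (hi.norm.mul_const K)).mul_const _
    · intro n
      filter_upwards [ae_all_iff.2 hB] with X hX
      refine (norm_sum_le _ _).trans (Finset.sum_le_sum fun ℓ _ => ?_)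
      rw [norm_smul]
      refine mul_le_mul ?_ (hX ℓ) (norm_nonneg _) (by
        have := (norm_nonneg _).trans (hK 0)
        positivity)
      rw [hder]
      refine (norm_add_le _ _).trans (add_le_add ?_ ?_)
      · rw [norm_mul]
        refine mul_le_of_le_one_left (norm_nonneg _) ?_
        rw [Real.norm_of_nonneg χ.nonneg]
        exact χ.le_one
      · rw [norm_mul, norm_mul, Real.norm_of_nonneg (ht0 n).le]
        refine mul_le_mul_of_nonneg_left ?_ (norm_nonneg _)
        refine (mul_le_of_le_one_left (norm_nonneg _) (ht1 n)).trans ?_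
        refine (ContinuousLinearMap.le_opNorm _ _).trans ?_
        simpa using hK (t n • X)
    · refine Eventually.of_forall fun X => ?_
      refine tendsto_finsetSum _ fun ℓ _ => Tendsto.smul_const ?_ _
      simp only [hder]
      have htX : Tendsto (fun n => t n • X) atTop (𝓝 0) := by simpa using htl.smul_const X
      have l1 : Tendsto (fun n => c n X) atTop (𝓝 1) := by
        have := (hχ.continuous.tendsto 0).comp htX
        rwa [χ.one_of_mem_closedBall (by simp [χ.rIn_pos.le])] at this
      have l2 : Tendsto (fun n => fderiv ℝ χ (t n • X) (EuclideanSpace.single (j, ℓ) 1)) atTop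
          (𝓝 (fderiv ℝ χ 0 (EuclideanSpace.single (j, ℓ) 1))) :=
        (((hχ.continuous_fderiv (by simp)).clm_apply continuous_const).tendsto 0).comp htX
      simpa using (l1.mul_const (fderiv ℝ ρ X (EuclideanSpace.single (j, ℓ) 1))).add
        ((htl.mul l2).const_mul (ρ X))
  simp only [hzero] at hlim
  exact (tendsto_nhds_unique hlim tendsto_const_nhds)

end Divergence

/-! ### Densities of Schwartz functions and divergence-free fields -/

section Density

variable {d N : ℕ}

theorem schwartz_density_fderiv (φ : 𝓢(Config d N, ℂ)) (X m : Config d N) :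
    ((fderiv ℝ (fun X => ‖φ X‖ ^ 2) X m : ℝ) : ℂ) =
      starRingEnd ℂ (∂_{m} φ X) * φ X + starRingEnd ℂ (φ X) * ∂_{m} φ X := by
  have h := (φ.hasFDerivAt X).norm_sq
  rw [h.fderiv, SchwartzMap.lineDerivOp_apply_eq_fderiv]
  simp only [smul_apply, ContinuousLinearMap.comp_apply, innerSL_apply_apply]
  rw [Complex.inner]
  apply Complex.ext <;> simp <;> ring

theorem schwartz_density_contDiff (φ : 𝓢(Config d N, ℂ)) :
    ContDiff ℝ ((⊤ : ℕ∞) : WithTop ℕ∞) (fun X => ‖φ X‖ ^ 2) :=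
  φ.smooth'.norm_sq ℝ

theorem schwartz_integrable_conj_mul (φ χ : 𝓢(Config d N, ℂ)) :
    Integrable fun X => starRingEnd ℂ (φ X) * χ X := by
  refine (integrable_conj_mul (φ.toLp 2) (χ.toLp 2)).congr ?_
  filter_upwards [φ.coeFn_toLp 2 volume, χ.coeFn_toLp 2 volume] with X h1 h2
  rw [h1, h2]

theorem schwartz_density_integrable (φ : 𝓢(Config d N, ℂ)) :
    Integrable fun X => ‖φ X‖ ^ 2 := by
  refine (schwartz_integrable_conj_mul φ φ).norm.congr (Filter.Eventually.of_forall fun X => ?_)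
  simp [sq]

theorem schwartz_density_fderiv_integrable (φ : 𝓢(Config d N, ℂ)) (m : Config d N) :
    Integrable fun X => fderiv ℝ (fun X => ‖φ X‖ ^ 2) X m := by
  have h := (schwartz_integrable_conj_mul (∂_{m} φ) φ).add
    (schwartz_integrable_conj_mul φ (∂_{m} φ))
  refine h.re.congr (Filter.Eventually.of_forall fun X => ?_)
  simp only [Pi.add_apply, ← schwartz_density_fderiv]
  simp

/-- Since `conj(p) ψ - conj(ψ) p = i ∂|ψ|²` for `p = -i∂ψ`, this is the divergence condition tested
with `|ψ|²`. It holds for Schwartz functions, whose density is smooth and integrable with its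
gradient, and extends to `H¹` by approximation. -/
theorem InH1.integral_current_divergence {ψ : Wave d N} (hψ : InH1 ψ) (j : Fin N)
    {h : Fin d → Position d → ℂ} (hh : ∀ ℓ, MemLp (h ℓ) ⊤)
    (hdiv : ∀ φ : Position d → ℝ, ContDiff ℝ ((⊤ : ℕ∞) : WithTop ℕ∞) φ → HasCompactSupport φ →
      ∫ x, ∑ ℓ, (fderiv ℝ φ x (EuclideanSpace.single ℓ 1)) • h ℓ x = 0) :
    ∑ ℓ, ∫ X, (starRingEnd ℂ (momentum ψ j ℓ X) * ψ X
      - starRingEnd ℂ (ψ X) * momentum ψ j ℓ X) * h ℓ (particle j X) = 0 := by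
  have h0 := hψ.integral_density j Finset.univ (h := fun ℓ X => h ℓ (particle j X))
    (fun ℓ => memLp_top_particle (hh ℓ) j) (b := fun _ => 0) MemLp.zero ?_
  · simpa using h0
  intro φ
  simp only [mul_zero, integral_zero, ← schwartz_density_fderiv]
  rw [← integral_divergence_integrable hh hdiv j (schwartz_density_contDiff φ)
    (schwartz_density_integrable φ) fun ℓ => schwartz_density_fderiv_integrable φ _,
    integral_finsetSum]
  · simp
  · intro ℓ _
    exact (schwartz_density_fderiv_integrable φ _).smul_of_top_left (memLp_top_particle (hh ℓ) j)

end Density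

/-! ### The Pauli-Fierz model -/

section PauliFierz

variable {𝔥 : Type*} [NormedAddCommGroup 𝔥] [InnerProductSpace ℂ 𝔥] [CompleteSpace 𝔥]

/-- With `A = √R`, `B = √(1 - R)` and `R = (1 + ω)⁻¹`, one has `B u = ω^{1/2} A u`. Symmetry of
`ω^{1/2}` therefore cancels it against `ω^{-1/2}`, and the unbounded operator leaves the pairing. -/
theorem Dispersion.inner_negHalfApply (ω : Dispersion 𝔥) {v : 𝔥} (hv : v ∈ ω.negHalf.domain)
    (u : 𝔥) : ⟪CFC.sqrt (1 - ω.resolvent) u, ω.negHalfApply v⟫_ℂ =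
      ⟪CFC.sqrt ω.resolvent u, v⟫_ℂ := by
  -- Triviality of the kernel makes the graph of the partial inverse the flipped graph of `ω^{1/2}`.
  -- It follows from injectivity of `ω`, the square of `ω^{1/2}`.
  have hker : LinearMap.ker ω.half.toFun = ⊥ := by
    rw [LinearMap.ker_eq_bot']
    intro x hx
    have h1 : ((x : 𝔥), (0 : 𝔥)) ∈ ω.half.graph := by
      rw [← hx]; exact ω.half.mem_graph x
    have h2 : ((x : 𝔥), (0 : 𝔥)) ∈ ω.op.graph :=
      (ω.half_isSqrt.2.2 _ _).2 ⟨0, h1, zero_mem _⟩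
    exact Subtype.ext (ω.graph_injective h2)
  have h3 : (v, ω.negHalfApply v) ∈ ω.half.inverse.graph := by
    rw [Dispersion.negHalfApply, dif_pos hv]
    exact ω.negHalf.mem_graph ⟨v, hv⟩
  rw [LinearPMap.inverse_graph hker] at h3
  have h4 : (ω.negHalfApply v, v) ∈ ω.half.graph := by
    simpa using h3
  exact Dispersion.symm_of_isSelfAdjoint ω.half_isSqrt.1 (ω.half_mem_graph u) h4

/-- `√(1 - R)` is self-adjoint, and injective because its square `1 - R` is. Only `0` is orthogonal
to its range. -/
theorem Dispersion.eq_zero_of_inner_sqrt (ω : Dispersion 𝔥) {y : 𝔥}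
    (h : ∀ u, ⟪CFC.sqrt (1 - ω.resolvent) u, y⟫_ℂ = 0) : y = 0 := by
  set B := CFC.sqrt (1 - ω.resolvent) with hB
  have hB0 : 0 ≤ B := CFC.sqrt_nonneg _
  have hBB : B * B = 1 - ω.resolvent := CFC.sqrt_mul_sqrt_self _ ω.resolvent_le_one
  have sB : ∀ u v, ⟪B u, v⟫_ℂ = ⟪u, B v⟫_ℂ :=
    ((ContinuousLinearMap.nonneg_iff_isPositive _).1 hB0).isSymmetric
  have h1 : B y = 0 := by
    refine ext_inner_left ℂ fun u => ?_
    rw [← sB, h, inner_zero_right]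
  apply ω.one_sub_resolvent_injective
  have h2 : (B * B) y = (1 - ω.resolvent) y := by rw [hBB]
  have h3 : B (B y) = y - ω.resolvent y := h2
  rw [← h3, h1, map_zero]

/-- In the Coulomb gauge, the divergence of the density does not couple to the field. -/
theorem InH1.integral_current_negHalf {N : ℕ} (ω : Dispersion 𝔥) {ψ : Wave 3 N} (hψ : InH1 ψ)
    (j : Fin N) {lam : Fin 3 → Position 3 → 𝔥} (hl : ∀ ℓ, IsFormFactor ω (lam ℓ))
    (hdiv : IsDivergenceFree lam) :
    ∑ ℓ, ∫ X, (starRingEnd ℂ (momentum ψ j ℓ X) * ψ X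
      - starRingEnd ℂ (ψ X) * momentum ψ j ℓ X) • ω.negHalfApply (lam ℓ (particle j X)) = 0 := by
  have hi : ∀ ℓ, Integrable fun X => (starRingEnd ℂ (momentum ψ j ℓ X) * ψ X
      - starRingEnd ℂ (ψ X) * momentum ψ j ℓ X) • ω.negHalfApply (lam ℓ (particle j X)) := fun ℓ =>
    ((integrable_conj_mul (momentum ψ j ℓ) ψ).sub
      (integrable_conj_mul ψ (momentum ψ j ℓ))).smul_of_top_left
        (memLp_top_particle (hl ℓ).2.2 j)
  -- Tested against `√(1 - R) u`, the field `ω^{-1/2} λ_ℓ` becomes the bounded scalar field `⟨√R u,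
  -- λ_ℓ⟩`, which inherits the weak divergence condition from `λ`.
  refine ω.eq_zero_of_inner_sqrt fun u => ?_
  rw [inner_sum]
  have h1 : ∀ w : 𝔥, ∀ ℓ, MemLp (fun x => ⟪w, lam ℓ x⟫_ℂ) ⊤ := fun w ℓ =>
    (hl ℓ).1.const_inner (𝕜 := ℂ) w
  rw [← hψ.integral_current_divergence j (h1 (CFC.sqrt ω.resolvent u))]
  · refine Finset.sum_congr rfl fun ℓ _ => ?_
    rw [← integral_inner (hi ℓ)]
    refine integral_congr_ae ?_
    filter_upwards [(quasiMeasurePreserving_particle (N := N) j).ae (hl ℓ).2.1] with X hX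
    rw [inner_smul_right, ω.inner_negHalfApply hX]
  · intro φ hφ hc
    have h2 := hdiv φ hφ hc
    have h3 : Integrable fun x => ∑ ℓ, (fderiv ℝ φ x (EuclideanSpace.single ℓ 1)) • lam ℓ x := by
      refine integrable_finsetSum _ fun ℓ _ => ?_
      have h4 : Integrable fun x => fderiv ℝ φ x (EuclideanSpace.single ℓ 1) := by
        refine Continuous.integrable_of_hasCompactSupport ?_ ?_
        · exact (hφ.continuous_fderiv (by simp)).clm_apply continuous_const
        · exact (hc.fderiv ℝ).comp_left (g := fun L : Position 3 →L[ℝ] ℝ =>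
            L (EuclideanSpace.single ℓ 1)) rfl
      exact h4.smul_of_top_left (hl ℓ).1
    have h5 := integral_inner (𝕜 := ℂ) h3 (CFC.sqrt ω.resolvent u)
    rw [h2, inner_zero_right] at h5
    rw [← h5]
    refine integral_congr_ae (Filter.Eventually.of_forall fun x => ?_)
    simp only [inner_sum, RCLike.real_smul_eq_coe_smul (K := ℂ), inner_smul_right]
    simp

end PauliFierz

/-! ### The kinetic energy as a convex quadratic function of the field -/

section PauliFierzQuadratic

variable {𝔥 : Type*} [NormedAddCommGroup 𝔥] [InnerProductSpace ℂ 𝔥]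
  {α : Type*} [MeasurableSpace α] {μ : Measure α}

theorem re_inner_real_smul (t : ℝ) (x y : 𝔥) : (⟪x, t • y⟫_ℂ).re = t * (⟪x, y⟫_ℂ).re := by
  rw [RCLike.real_smul_eq_coe_smul (K := ℂ), inner_smul_right]
  simp

theorem memLp_top_re_inner {ξ : α → 𝔥} (hξ : MemLp ξ ⊤ μ) (η : 𝔥) :
    MemLp (fun x => (⟪η, ξ x⟫_ℂ).re) ⊤ μ :=
  (hξ.const_inner (𝕜 := ℂ) η).re

variable [CompleteSpace 𝔥]

theorem re_inner_integral_real_smul {ξ : α → 𝔥} {w : α → ℝ}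
    (hi : Integrable (fun x => w x • ξ x) μ) (η : 𝔥) :
    (⟪η, ∫ x, w x • ξ x ∂μ⟫_ℂ).re = ∫ x, w x * (⟪η, ξ x⟫_ℂ).re ∂μ := by
  rw [← integral_inner hi η]
  have h2 := integral_re (𝕜 := ℂ) (hi.const_inner (𝕜 := ℂ) η)
  simp only [RCLike.re_to_complex] at h2
  rw [← h2]
  refine integral_congr_ae (Filter.Eventually.of_forall fun x => ?_)
  exact re_inner_real_smul _ _ _

/-- The positive operator `η ↦ ∫ |ψ|² Re ⟨η, ξ⟩ ξ`. -/
theorem exists_gramOperator (ψ : Lp ℂ 2 μ) {ξ : α → 𝔥} (hξ : MemLp ξ ⊤ μ) :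
    ∃ A : 𝔥 →L[ℝ] 𝔥, (∀ η, A η = ∫ x, ((⟪η, ξ x⟫_ℂ).re * ‖ψ x‖ ^ 2) • ξ x ∂μ) ∧
      ∀ η, 0 ≤ (⟪η, A η⟫_ℂ).re := by
  obtain ⟨C, hC0, hC⟩ := exists_ae_bound hξ
  have hi0 : ∀ η, Integrable (fun x => (⟪η, ξ x⟫_ℂ).re * ‖ψ x‖ ^ 2) μ := fun η =>
    (integrable_norm_sq ψ).smul_of_top_right (memLp_top_re_inner hξ η)
  have hi : ∀ η, Integrable (fun x => ((⟪η, ξ x⟫_ℂ).re * ‖ψ x‖ ^ 2) • ξ x) μ := fun η =>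
    (hi0 η).smul_of_top_left hξ
  let A : 𝔥 →ₗ[ℝ] 𝔥 :=
    { toFun := fun η => ∫ x, ((⟪η, ξ x⟫_ℂ).re * ‖ψ x‖ ^ 2) • ξ x ∂μ
      map_add' := fun η δ => by
        rw [← integral_add (hi η) (hi δ)]
        congr 1
        funext x
        rw [inner_add_left, Complex.add_re, add_mul, add_smul]
      map_smul' := fun t η => by
        rw [RingHom.id_apply, ← integral_smul]
        congr 1
        funext x
        rw [RCLike.real_smul_eq_coe_smul (K := ℂ) t η, inner_smul_left, smul_smul]
        simp [mul_assoc] }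
  refine ⟨A.mkContinuous (C ^ 2 * ‖ψ‖ ^ 2) fun η => ?_, fun η => rfl, fun η => ?_⟩
  · calc ‖A η‖ ≤ ∫ x, ‖ψ x‖ ^ 2 * (C ^ 2 * ‖η‖) ∂μ := by
          refine norm_integral_le_of_norm_le ((integrable_norm_sq ψ).mul_const _) ?_
          filter_upwards [hC] with x hx
          rw [norm_smul, norm_mul, Real.norm_of_nonneg (sq_nonneg ‖ψ x‖), Real.norm_eq_abs]
          have h1 : |(⟪η, ξ x⟫_ℂ).re| ≤ ‖η‖ * C :=
            (Complex.abs_re_le_norm _).trans ((norm_inner_le_norm _ _).trans (by gcongr))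
          calc |(⟪η, ξ x⟫_ℂ).re| * ‖ψ x‖ ^ 2 * ‖ξ x‖ ≤ (‖η‖ * C) * ‖ψ x‖ ^ 2 * C := by gcongr
            _ = _ := by ring
      _ = C ^ 2 * ‖ψ‖ ^ 2 * ‖η‖ := by rw [integral_mul_const, integral_norm_sq]; ring
  · change 0 ≤ (⟪η, ∫ x, ((⟪η, ξ x⟫_ℂ).re * ‖ψ x‖ ^ 2) • ξ x ∂μ⟫_ℂ).re
    rw [re_inner_integral_real_smul (hi η)]
    refine integral_nonneg fun x => ?_
    have : (⟪η, ξ x⟫_ℂ).re * ‖ψ x‖ ^ 2 * (⟪η, ξ x⟫_ℂ).re =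
      ((⟪η, ξ x⟫_ℂ).re) ^ 2 * ‖ψ x‖ ^ 2 := by ring
    rw [this]
    positivity

theorem integrable_kinetic (p ψ : Lp ℂ 2 μ) {a : α → ℝ} (ha : MemLp a ⊤ μ) :
    Integrable (fun x => ‖p x + (a x : ℂ) * ψ x‖ ^ 2) μ := by
  have h1 : MemLp (fun x => (a x : ℂ) * ψ x) 2 μ := (Lp.memLp ψ).mul ha.ofReal
  exact ((Lp.memLp p).add h1).integrable_norm_pow (p := 2) (by norm_num)

/-- The kinetic energy is a convex function of the field. -/
theorem kinetic_gradient_le (p ψ : Lp ℂ 2 μ) {ξ : α → 𝔥} (hξ : MemLp ξ ⊤ μ) (e : ℝ) (η δ : 𝔥) :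
    (∫ x, ‖p x + (e * (2 * (⟪η, ξ x⟫_ℂ).re) : ℝ) * ψ x‖ ^ 2 ∂μ) +
      4 * (⟪δ - η, ∫ x, (e * (starRingEnd ℂ (ψ x) * p x).re
        + 2 * e ^ 2 * (⟪η, ξ x⟫_ℂ).re * ‖ψ x‖ ^ 2) • ξ x ∂μ⟫_ℂ).re ≤
      ∫ x, ‖p x + (e * (2 * (⟪δ, ξ x⟫_ℂ).re) : ℝ) * ψ x‖ ^ 2 ∂μ := by
  have ha : ∀ η, MemLp (fun x => e * (2 * (⟪η, ξ x⟫_ℂ).re)) ⊤ μ := fun η =>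
    ((memLp_top_re_inner hξ η).const_mul 2).const_mul e
  have hw : Integrable (fun x => e * (starRingEnd ℂ (ψ x) * p x).re
        + 2 * e ^ 2 * (⟪η, ξ x⟫_ℂ).re * ‖ψ x‖ ^ 2) μ :=
    ((integrable_conj_mul ψ p).re.const_mul e).add
      ((integrable_norm_sq ψ).smul_of_top_right ((memLp_top_re_inner hξ η).const_mul (2 * e ^ 2)))
  have hwξ := hw.smul_of_top_left hξ
  have hwr : Integrable (fun x => (e * (starRingEnd ℂ (ψ x) * p x).re
        + 2 * e ^ 2 * (⟪η, ξ x⟫_ℂ).re * ‖ψ x‖ ^ 2) * (⟪δ - η, ξ x⟫_ℂ).re) μ :=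
    hw.smul_of_top_left (memLp_top_re_inner hξ (δ - η))
  rw [re_inner_integral_real_smul hwξ, ← integral_const_mul,
    ← integral_add (integrable_kinetic p ψ (ha η)) (hwr.const_mul 4)]
  refine integral_mono ((integrable_kinetic p ψ (ha η)).add (hwr.const_mul 4))
    (integrable_kinetic p ψ (ha δ)) fun x => ?_
  simp only [inner_sub_left, Complex.sub_re, ← Complex.normSq_eq_norm_sq, Complex.normSq_apply,
    Complex.add_re, Complex.add_im, Complex.mul_re, Complex.mul_im, Complex.ofReal_re,
    Complex.ofReal_im, Complex.conj_re, Complex.conj_im]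
  generalize (⟪η, ξ x⟫_ℂ).re = s
  generalize (⟪δ, ξ x⟫_ℂ).re = t
  -- Pointwise, the kinetic density exceeds its linearization by exactly `4 e² (t - s)² |ψ|²`.
  nlinarith [sq_nonneg (e * (t - s) * (ψ x).re), sq_nonneg (e * (t - s) * (ψ x).im)]

end PauliFierzQuadratic

/-! ### The Pauli-Fierz gradient and its zero -/

section PauliFierzModel

variable {𝔥 : Type*} [NormedAddCommGroup 𝔥] [InnerProductSpace ℂ 𝔥] [CompleteSpace 𝔥]

/-- The contribution of one component of the current of the `j`-th particle to the gradient of the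
Pauli-Fierz energy with respect to the field. -/
noncomputable def currentField {N : ℕ} (ω : Dispersion 𝔥) (e : ℝ)
    (lam : Fin N → Fin 3 → Position 3 → 𝔥) (ψ : Wave 3 N) (η : 𝔥) (j : Fin N) (ℓ : Fin 3) : 𝔥 :=
  ∫ X, (e * (starRingEnd ℂ (ψ X) * momentum ψ j ℓ X).re
    + 2 * e ^ 2 * (⟪η, ω.negHalfApply (lam j ℓ (particle j X))⟫_ℂ).re * ‖ψ X‖ ^ 2)
      • ω.negHalfApply (lam j ℓ (particle j X))

/-- Half the gradient of the Pauli-Fierz energy with respect to the field. -/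
noncomputable def pauliFierzGradient {N : ℕ} (ω : Dispersion 𝔥) (m : Fin N → ℝ) (e : ℝ)
    (lam : Fin N → Fin 3 → Position 3 → 𝔥) (ψ : Wave 3 N) (η : 𝔥) : 𝔥 :=
  η + ∑ j, (1 / m j) • ∑ ℓ, currentField ω e lam ψ η j ℓ

/-- The field equation contains `conj(ψ) p`, the gradient only its real part. They differ by `-(1/2)
(conj(p) ψ - conj(ψ) p)`, whose pairing with `ω^{-1/2} λ` vanishes in the Coulomb gauge after
summation over the components `ℓ`. The identity thus concerns the sums, not the individual
components. -/
theorem sum_currentField_eq {N : ℕ} (ω : Dispersion 𝔥) (e : ℝ)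
    {lam : Fin N → Fin 3 → Position 3 → 𝔥} (hl : ∀ j ℓ, IsFormFactor ω (lam j ℓ))
    (hdiv : ∀ j, IsDivergenceFree (lam j)) {ψ : Wave 3 N} (hψ : InH1 ψ) (η : 𝔥) (j : Fin N) :
    ∑ ℓ, ∫ X, (e * (starRingEnd ℂ (ψ X) * momentum ψ j ℓ X)
      + 2 * e ^ 2 * (⟪η, ω.negHalfApply (lam j ℓ (particle j X))⟫_ℂ).re * ‖ψ X‖ ^ 2 : ℂ)
      • ω.negHalfApply (lam j ℓ (particle j X)) = ∑ ℓ, currentField ω e lam ψ η j ℓ := by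
  have h0 := hψ.integral_current_negHalf ω j (hl j) (hdiv j)
  have h1 : ∑ ℓ, currentField ω e lam ψ η j ℓ = ∑ ℓ, currentField ω e lam ψ η j ℓ +
      (-(e / 2 : ℂ)) • ∑ ℓ, ∫ X, (starRingEnd ℂ (momentum ψ j ℓ X) * ψ X
      - starRingEnd ℂ (ψ X) * momentum ψ j ℓ X) •
        ω.negHalfApply (lam j ℓ (particle j X)) := by
    rw [h0, smul_zero, add_zero]
  rw [h1, Finset.smul_sum, ← Finset.sum_add_distrib]
  refine Finset.sum_congr rfl fun ℓ _ => ?_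
  have hξ := memLp_top_particle (N := N) (hl j ℓ).2.2 j
  rw [currentField, ← integral_smul, ← integral_add]
  · refine integral_congr_ae (Filter.Eventually.of_forall fun X => ?_)
    simp only
    rw [RCLike.real_smul_eq_coe_smul (K := ℂ), smul_smul, ← add_smul]
    congr 1
    have hre : ((starRingEnd ℂ (ψ X) * momentum ψ j ℓ X).re : ℂ) =
        (starRingEnd ℂ (ψ X) * momentum ψ j ℓ X
          + ψ X * starRingEnd ℂ (momentum ψ j ℓ X)) / 2 := by
      rw [Complex.re_eq_add_conj]
      simp
    push_cast
    simp only [Complex.coe_algebraMap, hre]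
    ring
  · have hw : Integrable (fun X => e * (starRingEnd ℂ (ψ X) * momentum ψ j ℓ X).re
        + 2 * e ^ 2 * (⟪η, ω.negHalfApply (lam j ℓ (particle j X))⟫_ℂ).re * ‖ψ X‖ ^ 2) :=
      ((integrable_conj_mul ψ (momentum ψ j ℓ)).re.const_mul e).add
        ((integrable_norm_sq ψ).smul_of_top_right
          ((memLp_top_re_inner hξ η).const_mul (2 * e ^ 2)))
    exact hw.smul_of_top_left hξ
  · exact (((integrable_conj_mul (momentum ψ j ℓ) ψ).sub
      (integrable_conj_mul ψ (momentum ψ j ℓ))).smul_of_top_left hξ).smul (-(e / 2 : ℂ))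

theorem pauliFierzFieldEq_iff {N : ℕ} (ω : Dispersion 𝔥) (m : Fin N → ℝ) (e : ℝ)
    {lam : Fin N → Fin 3 → Position 3 → 𝔥} (hl : ∀ j ℓ, IsFormFactor ω (lam j ℓ))
    (hdiv : ∀ j, IsDivergenceFree (lam j)) {ψ : Wave 3 N} (hψ : InH1 ψ) (η : 𝔥) :
    pauliFierzFieldEq ω m e lam ψ η ↔ pauliFierzGradient ω m e lam ψ η = 0 := by
  simp only [pauliFierzFieldEq, pauliFierzGradient, sum_currentField_eq ω e hl hdiv hψ]

/-- The gradient is `η + A η + b`, where `A` is a combination of positive Gram operators with the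
non-negative weights `2 e² / m_j`. Monotonicity of `A` produces the zero. -/
theorem exists_pauliFierzGradient_eq_zero {N : ℕ} (ω : Dispersion 𝔥) {m : Fin N → ℝ}
    (hm : ∀ j, 0 < m j) (e : ℝ) {lam : Fin N → Fin 3 → Position 3 → 𝔥}
    (hl : ∀ j ℓ, IsFormFactor ω (lam j ℓ)) (ψ : Wave 3 N) :
    ∃ η, pauliFierzGradient ω m e lam ψ η = 0 := by
  have hξ := fun j ℓ => memLp_top_particle (N := N) (hl j ℓ).2.2 j
  choose A hA hA0 using fun j ℓ => exists_gramOperator ψ (hξ j ℓ)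
  let b : Fin N → Fin 3 → 𝔥 := fun j ℓ => ∫ X,
    (e * (starRingEnd ℂ (ψ X) * momentum ψ j ℓ X).re) • ω.negHalfApply (lam j ℓ (particle j X))
  have hsplit : ∀ η j ℓ, currentField ω e lam ψ η j ℓ = (2 * e ^ 2) • A j ℓ η + b j ℓ := by
    intro η j ℓ
    rw [hA, currentField, ← integral_smul, ← integral_add]
    · refine integral_congr_ae (Filter.Eventually.of_forall fun X => ?_)
      simp only
      rw [smul_smul, ← add_smul]
      congr 1
      ring
    · have h1 : Integrable fun X => (⟪η, ω.negHalfApply (lam j ℓ (particle j X))⟫_ℂ).re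
          * ‖ψ X‖ ^ 2 :=
        (integrable_norm_sq ψ).smul_of_top_right (memLp_top_re_inner (hξ j ℓ) η)
      exact (h1.smul_of_top_left (hξ j ℓ)).smul (2 * e ^ 2)
    · have h1 : Integrable fun X => e * (starRingEnd ℂ (ψ X) * momentum ψ j ℓ X).re :=
        (integrable_conj_mul ψ (momentum ψ j ℓ)).re.const_mul e
      exact h1.smul_of_top_left (hξ j ℓ)
  have hmono : ∀ x, 0 ≤ (⟪x, (∑ j, (1 / m j) • ∑ ℓ, (2 * e ^ 2) • A j ℓ) x⟫_ℂ).re := by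
    intro x
    simp only [sum_apply, smul_apply, inner_sum, Complex.re_sum, re_inner_real_smul]
    exact Finset.sum_nonneg fun j _ => mul_nonneg (one_div_nonneg.2 (hm j).le)
      (Finset.sum_nonneg fun ℓ _ => mul_nonneg (by positivity) (hA0 j ℓ x))
  obtain ⟨η, hη⟩ := exists_zero_of_monotone _ hmono (∑ j, (1 / m j) • ∑ ℓ, b j ℓ)
  refine ⟨η, ?_⟩
  rw [← hη, pauliFierzGradient, add_assoc]
  simp [hsplit, Finset.sum_add_distrib, smul_add]

theorem pauliFierz_variationalEquivalence (ω : Dispersion 𝔥) {N : ℕ} {W : Config 3 N → ℝ}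
    (hW : IsPotential W) {m : Fin N → ℝ} (hm : ∀ j, 0 < m j) (e : ℝ)
    {lam : Fin N → Fin 3 → Position 3 → 𝔥} (hl : ∀ j ℓ, IsFormFactor ω (lam j ℓ))
    (hdiv : ∀ j, IsDivergenceFree (lam j)) :
    VariationalEquivalence (pauliFierzEnergy ω m e lam W) ω.halfIso
      (pauliFierzFieldEq ω m e lam) := by
  let f : Wave 3 N → 𝔥 → ℝ := fun ψ η =>
    (∑ j, 1 / (2 * m j) * (∑ ℓ, (∫ X, ‖momentum ψ j ℓ X
        + (e * (2 * (⟪η, ω.negHalfApply (lam j ℓ (particle j X))⟫_ℂ).re) : ℝ) * ψ X‖ ^ 2)))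
      + (∫ X, W X * ‖ψ X‖ ^ 2) + ‖η‖ ^ 2
  refine variationalEquivalence_of_gradient (formDomain W) f (pauliFierzGradient ω m e lam) 0
    ?_ ?_ ?_ ?_ ?_ ?_
  · intro ψ hψ z
    simp [pauliFierzEnergy, hψ]
  · intro ψ hψ h1 η
    simp only [pauliFierzEnergy, hψ, if_true, vectorPotential, ω.pairing_symm,
      LinearIsometryEquiv.norm_map, f]
  · intro ψ hψ h1 η
    have h2 : 0 ≤ ∫ X, W X * ‖ψ X‖ ^ 2 := by
      refine integral_nonneg_of_ae ?_
      filter_upwards [hW.2] with X hX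
      positivity
    have h3 : ∀ j, 0 ≤ 1 / (2 * m j) := fun j => by have := hm j; positivity
    exact add_nonneg (add_nonneg (Finset.sum_nonneg fun j _ => mul_nonneg (h3 j)
      (Finset.sum_nonneg fun ℓ _ => integral_nonneg fun X => sq_nonneg _)) h2) (sq_nonneg _)
  · intro ψ hψ h1 η δ
    have hkin : ∀ j, 1 / (2 * m j) * (∑ ℓ, (∫ X, ‖momentum ψ j ℓ X
          + (e * (2 * (⟪η, ω.negHalfApply (lam j ℓ (particle j X))⟫_ℂ).re) : ℝ) * ψ X‖ ^ 2))
        + 2 * (⟪δ - η, (1 / m j) • ∑ ℓ, currentField ω e lam ψ η j ℓ⟫_ℂ).re ≤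
        1 / (2 * m j) * (∑ ℓ, (∫ X, ‖momentum ψ j ℓ X
          + (e * (2 * (⟪δ, ω.negHalfApply (lam j ℓ (particle j X))⟫_ℂ).re) : ℝ) * ψ X‖ ^ 2)) := by
      intro j
      have hmj := hm j
      -- The factor `4` in the convexity inequality times `1 / (2 m_j)` is the factor `2 / m_j`
      -- required by a half gradient with weights `1 / m_j`.
      have e1 : 2 * (⟪δ - η, (1 / m j) • ∑ ℓ, currentField ω e lam ψ η j ℓ⟫_ℂ).re =
          1 / (2 * m j) * ∑ ℓ, 4 * (⟪δ - η, currentField ω e lam ψ η j ℓ⟫_ℂ).re := by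
        rw [re_inner_real_smul, inner_sum, Complex.re_sum, ← Finset.mul_sum]
        field_simp
        ring
      rw [e1, ← mul_add, ← Finset.sum_add_distrib]
      refine mul_le_mul_of_nonneg_left (Finset.sum_le_sum fun ℓ _ => ?_) (by positivity)
      exact kinetic_gradient_le (momentum ψ j ℓ) ψ (memLp_top_particle (hl j ℓ).2.2 j) e η δ
    have hsum := Finset.sum_le_sum fun j (_ : j ∈ Finset.univ) => hkin j
    rw [Finset.sum_add_distrib, ← Finset.mul_sum, ← Complex.re_sum, ← inner_sum] at hsum
    -- The field energy `‖η‖²` alone supplies the quadratic gain; the kinetic term only has to be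
    -- convex.
    have hq := hasStrongGradient_linear 0 (0 : 𝔥) η δ
    simp only [inner_zero_right, add_zero, Complex.zero_re, mul_zero, zero_add] at hq
    simp only [f, pauliFierzGradient, inner_add_right, Complex.add_re]
    linarith
  · intro ψ hψ h1 η
    exact pauliFierzFieldEq_iff ω m e hl hdiv hψ.1 η
  · intro ψ hψ h1
    exact exists_pauliFierzGradient_eq_zero ω hm e hl ψ

end PauliFierzModel

/-! ### The polaron -/

section PolaronFourier

variable {d N : ℕ}

/-- The plane wave `e^{i k · x_j}`. -/
noncomputable def planeWave (j : Fin N) (k : Position d) (X : Config d N) : ℂ :=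
  Complex.exp (Complex.I * (⟪k, particle j X⟫_ℝ : ℝ))

theorem norm_planeWave (j : Fin N) (k : Position d) (X : Config d N) : ‖planeWave j k X‖ = 1 :=
  Complex.norm_exp_I_mul_ofReal _

theorem continuous_planeWave_uncurry (j : Fin N) :
    Continuous fun p : Config d N × Position d => planeWave j p.2 p.1 := by
  have := (continuous_particle (d := d) j).comp (continuous_fst (X := Config d N) (Y := Position d))
  unfold planeWave
  simp only [Function.comp_def] at this
  fun_prop

theorem continuous_planeWave (j : Fin N) (k : Position d) : Continuous (planeWave j k) :=
  (continuous_planeWave_uncurry j).comp (Continuous.prodMk_left k)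

theorem memLp_planeWave (j : Fin N) (k : Position d) : MemLp (planeWave j k) ⊤ :=
  memLp_top_of_bound (continuous_planeWave j k).aestronglyMeasurable 1
    (Filter.Eventually.of_forall fun X => (norm_planeWave j k X).le)

theorem differentiableAt_and_fderiv_planeWave (j : Fin N) (k : Position d) (X : Config d N) (ℓ : Fin d) :
    DifferentiableAt ℝ (planeWave j k) X ∧
      fderiv ℝ (planeWave j k) X (EuclideanSpace.single (j, ℓ) 1) =
        Complex.I * k ℓ * planeWave j k X := by
  have e : ∀ X : Config d N, (⟪k, particle j X⟫_ℝ : ℝ) = ∑ i, k i * X (j, i) := by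
    intro X
    simp [PiLp.inner_apply, particle, mul_comm]
  let L : Config d N →L[ℝ] ℝ := ∑ i, k i • EuclideanSpace.proj (j, i)
  have hL : ∀ X : Config d N, (⟪k, particle j X⟫_ℝ : ℝ) = L X := by
    intro X
    rw [e]
    simp [L]
  have hw : planeWave j k = fun X => Complex.exp (Complex.I * (L X : ℝ)) := by
    funext X
    rw [planeWave, hL]
  have h1 : HasFDerivAt (fun X => Complex.I * ((L X : ℝ) : ℂ))
      (Complex.I • (Complex.ofRealCLM.comp L)) X :=
    ((Complex.ofRealCLM.hasFDerivAt.comp X L.hasFDerivAt)).const_mul Complex.I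
  have h2 := h1.cexp
  rw [hw]
  refine ⟨h2.differentiableAt, ?_⟩
  rw [h2.fderiv]
  have h3 : L (EuclideanSpace.single (j, ℓ) 1) = k ℓ := by
    simp [L, PiLp.single_apply]
  simp [h3]
  ring

/-- Integration by parts moves the derivative from `|φ|²` to the plane wave, which is multiplied by
`i k_ℓ`. -/
theorem schwartz_integral_planeWave (φ : 𝓢(Config d N, ℂ)) (j : Fin N) (k : Position d)
    (ℓ : Fin d) :
    ∫ X, (starRingEnd ℂ (∂_{(EuclideanSpace.single (j, ℓ) (1 : ℝ) : Config d N)} φ X) * φ X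
        + starRingEnd ℂ (φ X) * ∂_{(EuclideanSpace.single (j, ℓ) (1 : ℝ) : Config d N)} φ X)
        * planeWave j k X =
      ∫ X, starRingEnd ℂ (φ X) * φ X * (-(Complex.I * k ℓ) * planeWave j k X) := by
  set ρ : Config d N → ℂ := fun X => ((‖φ X‖ ^ 2 : ℝ) : ℂ) with hρ
  set e : Config d N := EuclideanSpace.single (j, ℓ) 1
  have hd : ∀ X, HasFDerivAt ρ (Complex.ofRealCLM.comp (fderiv ℝ (fun X => ‖φ X‖ ^ 2) X)) X :=
    fun X => Complex.ofRealCLM.hasFDerivAt.comp X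
      (((schwartz_density_contDiff φ).differentiable (by simp)) X).hasFDerivAt
  have hρ' : ∀ X, fderiv ℝ ρ X e =
      starRingEnd ℂ (∂_{e} φ X) * φ X + starRingEnd ℂ (φ X) * ∂_{e} φ X := by
    intro X
    rw [(hd X).fderiv, ← schwartz_density_fderiv]
    rfl
  have hρe : ∀ X, ρ X = starRingEnd ℂ (φ X) * φ X := by
    intro X
    rw [hρ, mul_comm, Complex.mul_conj, Complex.normSq_eq_norm_sq]
  have i1 : Integrable ρ := (schwartz_density_integrable φ).ofReal
  have i2 : Integrable fun X => fderiv ℝ ρ X e := by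
    simp only [hρ', ← schwartz_density_fderiv]
    exact (schwartz_density_fderiv_integrable φ e).ofReal
  have hw := memLp_planeWave (N := N) j k
  have hwd : ∀ X, fderiv ℝ (planeWave j k) X e = Complex.I * k ℓ * planeWave j k X :=
    fun X => (differentiableAt_and_fderiv_planeWave j k X ℓ).2
  have h := integral_mul_fderiv_eq_neg_fderiv_mul_of_integrable (μ := volume) (f := ρ)
    (g := planeWave j k) (v := e) (i2.smul_of_top_left hw) ?_ (i1.smul_of_top_left hw)
    (fun X _ => (hd X).differentiableAt) (fun X _ => (differentiableAt_and_fderiv_planeWave j k X ℓ).1)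
  · simp only [hwd, hρ'] at h
    rw [← neg_eq_iff_eq_neg, ← integral_neg] at h
    rw [← h]
    refine integral_congr_ae (Filter.Eventually.of_forall fun X => ?_)
    simp only [hρe]
    ring
  · simp only [hwd]
    exact i1.smul_of_top_left (hw.const_mul (Complex.I * k ℓ))

/-- The Fourier transform of the density of the `j`-th particle. -/
noncomputable def densityFourier (ψ : Wave d N) (j : Fin N) (k : Position d) : ℂ :=
  ∫ X, ((‖ψ X‖ ^ 2 : ℝ) : ℂ) * planeWave j k X

/-- The left side is the Fourier integral of `i ∂|ψ|²`, and integration by parts contributes `-i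
k_ℓ`. This factor `k_ℓ` is what the commutator form restores to the high-momentum form factor. -/
theorem InH1.integral_current_planeWave {ψ : Wave d N} (hψ : InH1 ψ) (j : Fin N) (k : Position d)
    (ℓ : Fin d) :
    ∫ X, (starRingEnd ℂ (momentum ψ j ℓ X) * ψ X
      - starRingEnd ℂ (ψ X) * momentum ψ j ℓ X) * planeWave j k X =
      k ℓ * densityFourier ψ j k := by
  have h := hψ.integral_density j {ℓ} (h := fun _ => planeWave j k)
    (fun _ => memLp_planeWave j k) (b := fun X => -(Complex.I * k ℓ) * planeWave j k X)
    ((memLp_planeWave j k).const_mul _) (fun φ => by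
      rw [Finset.sum_singleton]; exact schwartz_integral_planeWave φ j k ℓ)
  rw [Finset.sum_singleton] at h
  rw [h, densityFourier, ← integral_const_mul, ← integral_const_mul]
  refine integral_congr_ae (Filter.Eventually.of_forall fun X => ?_)
  simp only
  rw [← Complex.normSq_eq_norm_sq, ← Complex.mul_conj]
  linear_combination (-(k ℓ : ℂ) * starRingEnd ℂ (ψ X) * ψ X * planeWave j k X) * Complex.I_sq

theorem norm_densityFourier_le (ψ : Wave d N) (j : Fin N) (k : Position d) :
    ‖densityFourier ψ j k‖ ≤ ‖ψ‖ ^ 2 := by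
  rw [← integral_norm_sq]
  refine norm_integral_le_of_norm_le (integrable_norm_sq ψ) (Filter.Eventually.of_forall fun X => ?_)
  rw [norm_mul, norm_planeWave, mul_one, Complex.norm_real, Real.norm_of_nonneg (sq_nonneg _)]

theorem norm_integral_conj_mul_planeWave_le (φ ψ : Wave d N) (j : Fin N) (k : Position d) :
    ‖∫ X, starRingEnd ℂ (φ X) * ψ X * planeWave j k X‖ ≤ ‖φ‖ * ‖ψ‖ := by
  have hw := memLp_planeWave (N := N) j k
  rw [integral_conj_mul_mul_eq_inner φ ψ hw]
  refine (norm_inner_le_norm _ _).trans ?_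
  gcongr
  refine (Lp.norm_smul_le _ _).trans ?_
  refine mul_le_of_le_one_left (norm_nonneg _) ?_
  rw [Lp.norm_toLp]
  refine ENNReal.toReal_le_of_le_ofReal zero_le_one ?_
  rw [eLpNorm_exponent_top]
  refine eLpNormEssSup_le_of_ae_bound (Filter.Eventually.of_forall fun X => ?_)
  exact (norm_planeWave j k X).le

/-- Regularity of `ψ` becomes decay of the Fourier transform of the density: Cauchy-Schwarz is
applied to both terms of the current. -/
theorem InH1.abs_coord_mul_densityFourier_le {ψ : Wave d N} (hψ : InH1 ψ) (j : Fin N)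
    (k : Position d) (ℓ : Fin d) :
    |k ℓ| * ‖densityFourier ψ j k‖ ≤ 2 * ‖momentum ψ j ℓ‖ * ‖ψ‖ := by
  have h := hψ.integral_current_planeWave j k ℓ
  simp only [sub_mul] at h
  rw [integral_sub (integrable_conj_mul_mul _ _ (memLp_planeWave j k))
    (integrable_conj_mul_mul _ _ (memLp_planeWave j k))] at h
  have h2 : |k ℓ| * ‖densityFourier ψ j k‖ = ‖(k ℓ : ℂ) * densityFourier ψ j k‖ := by
    rw [norm_mul, Complex.norm_real, Real.norm_eq_abs]
  rw [h2, ← h]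
  refine (norm_sub_le _ _).trans ?_
  have h3 := norm_integral_conj_mul_planeWave_le (momentum ψ j ℓ) ψ j k
  have h4 := norm_integral_conj_mul_planeWave_le ψ (momentum ψ j ℓ) j k
  linarith

theorem InH1.norm_mul_densityFourier_sq_le {ψ : Wave d N} (hψ : InH1 ψ) (j : Fin N)
    (k : Position d) :
    (‖k‖ * ‖densityFourier ψ j k‖) ^ 2 ≤ 4 * ‖ψ‖ ^ 2 * ∑ ℓ, ‖momentum ψ j ℓ‖ ^ 2 := by
  rw [mul_pow, EuclideanSpace.real_norm_sq_eq, Finset.sum_mul, Finset.mul_sum]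
  refine Finset.sum_le_sum fun ℓ _ => ?_
  have h := pow_le_pow_left₀ (by positivity) (hψ.abs_coord_mul_densityFourier_le j k ℓ) 2
  rw [mul_pow, sq_abs] at h
  refine h.trans_eq (by ring)

theorem integrable_planeWave_prod {w : Config d N → ℂ} (hw : Integrable w) {F : Position d → ℂ}
    (hF : Integrable F) (j : Fin N) :
    Integrable (fun p : Config d N × Position d => planeWave j p.2 p.1 * (w p.1 * F p.2))
      ((volume : Measure (Config d N)).prod (volume : Measure (Position d))) :=
  (hw.mul_prod hF).bdd_mul (c := 1) (continuous_planeWave_uncurry j).aestronglyMeasurable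
    (Filter.Eventually.of_forall fun p => (norm_planeWave j p.2 p.1).le)

/-- Fubini applies because the plane wave has modulus one and `w(X) F(k)` is integrable on the
product. -/
theorem integral_mul_inverse_fourier {w : Config d N → ℂ} (hw : Integrable w)
    {F : Position d → ℂ} (hF : Integrable F) (j : Fin N) :
    ∫ X, w X * (∫ k, planeWave j k X * F k) = ∫ k, F k * ∫ X, w X * planeWave j k X := by
  have h := integral_integral_swap (f := fun X k => planeWave j k X * (w X * F k))
    (integrable_planeWave_prod hw hF j)
  calc ∫ X, w X * (∫ k, planeWave j k X * F k)
      = ∫ X, ∫ k, planeWave j k X * (w X * F k) := by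
        congr 1; funext X; rw [← integral_const_mul]; congr 1; funext k; ring
    _ = ∫ k, ∫ X, planeWave j k X * (w X * F k) := h
    _ = _ := by congr 1; funext k; rw [← integral_const_mul]; congr 1; funext X; ring

theorem integrable_mul_fourier {w : Config d N → ℂ} (hw : Integrable w)
    {F : Position d → ℂ} (hF : Integrable F) (j : Fin N) :
    Integrable fun k => F k * ∫ X, w X * planeWave j k X := by
  refine (integrable_planeWave_prod hw hF j).integral_prod_right.congr
    (Filter.Eventually.of_forall fun k => ?_)
  simp only
  rw [← integral_const_mul]; congr 1; funext X; ring

theorem aestronglyMeasurable_densityFourier (ψ : Wave d N) (j : Fin N) :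
    AEStronglyMeasurable (densityFourier ψ j) := by
  have h : AEStronglyMeasurable (fun p : Position d × Config d N =>
      ((‖ψ p.2‖ ^ 2 : ℝ) : ℂ) * planeWave j p.1 p.2)
      ((volume : Measure (Position d)).prod (volume : Measure (Config d N))) := by
    refine AEStronglyMeasurable.mul ?_ ?_
    · exact ((integrable_norm_sq ψ).ofReal (𝕜 := ℂ)).aestronglyMeasurable.comp_snd
    · exact ((continuous_planeWave_uncurry j).comp continuous_swap).aestronglyMeasurable
  exact h.integral_prod_right'

end PolaronFourier

/-! ### Square integrability of the low and high momentum form factors -/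

section PolaronRadial

open Filter Topology

variable {d : ℕ}

/-- The modulus `1_{|k| > ϱ} |k|^{-(d+1)/2}` of the high-momentum form factor. -/
noncomputable def highModulus (d : ℕ) (ϱ : ℝ) (k : Position d) : ℝ :=
  if ϱ < ‖k‖ then ‖k‖ ^ (-((d : ℝ) + 1) / 2) else 0

theorem highModulus_nonneg (ϱ : ℝ) (k : Position d) : 0 ≤ highModulus d ϱ k := by
  unfold highModulus
  split_ifs <;> positivity

theorem measurable_lowFactor (ϱ : ℝ) : Measurable (lowFactor d ϱ) :=
  Measurable.ite (measurableSet_le measurable_norm measurable_const) (by fun_prop) measurable_const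

theorem measurable_highModulus (ϱ : ℝ) : Measurable (highModulus d ϱ) :=
  Measurable.ite (measurableSet_lt measurable_const measurable_norm) (by fun_prop) measurable_const

theorem measurable_highFactor (ϱ : ℝ) (ℓ : Fin d) : Measurable (highFactor d ϱ ℓ) :=
  Measurable.ite (measurableSet_lt measurable_const measurable_norm) (by fun_prop) measurable_const

/-- In polar coordinates the Jacobian `r^{d-1}` cancels `r^{-(d-1)}`, leaving the indicator of `(0,
ϱ]`. Positivity of `d` makes the natural subtraction `d - 1` a true one. -/
theorem integrable_lowFactor_sq (hd : 0 < d) (ϱ : ℝ) :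
    Integrable fun k : Position d => lowFactor d ϱ k ^ 2 := by
  have : Nonempty (Fin d) := ⟨⟨0, hd⟩⟩
  have h := integrable_fun_norm_addHaar (E := Position d) volume
    (f := fun r : ℝ => (if r ≤ ϱ then r ^ (-((d : ℝ) - 1) / 2) else 0) ^ 2)
  refine h.2 ?_
  have h1 : IntegrableOn (fun _ : ℝ => (1 : ℝ)) (Set.Ioc 0 ϱ) := by
    simp
  have h2 : Integrable ((Set.Ioc 0 ϱ).indicator fun _ : ℝ => (1 : ℝ)) :=
    h1.integrable_indicator measurableSet_Ioc
  refine h2.integrableOn.congr_fun (fun r hr => ?_) measurableSet_Ioi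
  have hr0 : (0 : ℝ) < r := hr
  simp only [finrank_euclideanSpace, Fintype.card_fin, smul_eq_mul, Set.indicator, Set.mem_Ioc, hr0,
    true_and]
  split_ifs with h3
  · rw [← Real.rpow_natCast, ← Real.rpow_natCast, ← Real.rpow_mul hr0.le, ← Real.rpow_add hr0,
      Nat.cast_sub (Nat.succ_le_of_lt hd)]
    symm
    convert Real.rpow_zero r using 2
    push_cast
    ring
  · simp

/-- In polar coordinates the integrand is `r^{d-1} r^{-(d+1)} = r^{-2}`, integrable away from the
origin. -/
theorem integrable_highModulus_sq (hd : 0 < d) {ϱ : ℝ} (hϱ : 0 < ϱ) :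
    Integrable fun k : Position d => highModulus d ϱ k ^ 2 := by
  have : Nonempty (Fin d) := ⟨⟨0, hd⟩⟩
  have h := integrable_fun_norm_addHaar (E := Position d) volume
    (f := fun r : ℝ => (if ϱ < r then r ^ (-((d : ℝ) + 1) / 2) else 0) ^ 2)
  refine h.2 ?_
  have h1 : IntegrableOn (fun r : ℝ => r ^ (-2 : ℝ)) (Set.Ioi ϱ) :=
    integrableOn_Ioi_rpow_of_lt (by norm_num) hϱ
  have h2 : Integrable ((Set.Ioi ϱ).indicator fun r : ℝ => r ^ (-2 : ℝ)) :=
    h1.integrable_indicator measurableSet_Ioi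
  refine h2.integrableOn.congr_fun (fun r hr => ?_) measurableSet_Ioi
  have hr0 : (0 : ℝ) < r := hr
  simp only [finrank_euclideanSpace, Fintype.card_fin, smul_eq_mul, Set.indicator, Set.mem_Ioi]
  split_ifs with h3
  · rw [← Real.rpow_natCast, ← Real.rpow_natCast, ← Real.rpow_mul hr0.le, ← Real.rpow_add hr0,
      Nat.cast_sub (Nat.succ_le_of_lt hd)]
    congr 1
    push_cast
    ring
  · simp

/-- The smallness of this tail is what lets the kinetic energy absorb the interaction at high
momenta. The integrand is dominated by its value at cut-off `1` and vanishes eventually at each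
point. -/
theorem tendsto_integral_highModulus_sq (hd : 0 < d) :
    Tendsto (fun n : ℕ => ∫ k : Position d, highModulus d ((n : ℝ) + 1) k ^ 2) atTop (𝓝 0) := by
  have h0 : ∫ _ : Position d, (0 : ℝ) = 0 := by simp
  rw [← h0]
  refine tendsto_integral_of_dominated_convergence (fun k => highModulus d 1 k ^ 2)
    (fun n => ((measurable_highModulus _).pow_const 2).aestronglyMeasurable)
    (integrable_highModulus_sq hd one_pos) (fun n => Eventually.of_forall fun k => ?_)
    (Eventually.of_forall fun k => ?_)
  · rw [Real.norm_of_nonneg (sq_nonneg _)]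
    refine pow_le_pow_left₀ (highModulus_nonneg _ _) ?_ 2
    by_cases h : (n : ℝ) + 1 < ‖k‖
    · have h' : 1 < ‖k‖ := lt_of_le_of_lt (by linarith [Nat.cast_nonneg (α := ℝ) n]) h
      simp [highModulus, h, h']
    · rw [highModulus, if_neg h]
      exact highModulus_nonneg _ _
  · refine tendsto_const_nhds.congr' ?_
    obtain ⟨n₀, hn₀⟩ := exists_nat_ge ‖k‖
    filter_upwards [eventually_ge_atTop n₀] with n hn
    have : ¬ (n : ℝ) + 1 < ‖k‖ := by
      have : (n₀ : ℝ) ≤ n := by exact_mod_cast hn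
      linarith
    simp [highModulus, this]

theorem memLp_lowFactor (hd : 0 < d) (ϱ : ℝ) : MemLp (lowFactor d ϱ) 2 :=
  (memLp_two_iff_integrable_sq (measurable_lowFactor ϱ).aestronglyMeasurable).2
    (integrable_lowFactor_sq hd ϱ)

theorem memLp_highModulus (hd : 0 < d) {ϱ : ℝ} (hϱ : 0 < ϱ) : MemLp (highModulus d ϱ) 2 :=
  (memLp_two_iff_integrable_sq (measurable_highModulus ϱ).aestronglyMeasurable).2
    (integrable_highModulus_sq hd hϱ)

theorem memLp_highFactor (hd : 0 < d) {ϱ : ℝ} (hϱ : 0 < ϱ) (ℓ : Fin d) :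
    MemLp (highFactor d ϱ ℓ) 2 := by
  refine (memLp_highModulus hd hϱ).mono' (measurable_highFactor ϱ ℓ).aestronglyMeasurable
    (Eventually.of_forall fun k => ?_)
  unfold highFactor highModulus
  split_ifs with h
  · rw [norm_mul, Real.norm_of_nonneg (by positivity)]
    refine mul_le_of_le_one_right (by positivity) ?_
    rw [norm_div, norm_norm]
    exact div_le_one_of_le₀ (PiLp.norm_apply_le k ℓ) (norm_nonneg _)
  · simp

/-- The form factor recombines from its low and high momentum parts. -/
theorem lowFactor_add_sum_highFactor {ϱ : ℝ} (hϱ : 0 < ϱ) (k : Position d) :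
    lowFactor d ϱ k + ∑ ℓ, highFactor d ϱ ℓ k * k ℓ = ‖k‖ ^ (-((d : ℝ) - 1) / 2) := by
  by_cases h : ‖k‖ ≤ ϱ
  · have h' : ¬ ϱ < ‖k‖ := not_lt.2 h
    simp [lowFactor, highFactor, h, h']
  · have h' : ϱ < ‖k‖ := not_le.1 h
    have hk : 0 < ‖k‖ := hϱ.trans h'
    simp only [lowFactor, highFactor, h, h', if_true, if_false, zero_add]
    have e : ∀ ℓ, ‖k‖ ^ (-((d : ℝ) + 1) / 2) * (k ℓ / ‖k‖) * k ℓ =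
        ‖k‖ ^ (-((d : ℝ) + 1) / 2) / ‖k‖ * k ℓ ^ 2 := fun ℓ => by ring
    simp only [e]
    rw [← Finset.mul_sum, ← EuclideanSpace.real_norm_sq_eq]
    have e2 : ‖k‖ ^ (-((d : ℝ) + 1) / 2) / ‖k‖ * ‖k‖ ^ 2 =
        ‖k‖ ^ (-((d : ℝ) + 1) / 2) * ‖k‖ ^ (1 : ℝ) := by
      rw [Real.rpow_one]; field_simp
    rw [e2, ← Real.rpow_add hk]
    congr 1
    ring

/-- Pointwise bound by the low and the high momentum parts. -/
theorem rpow_mul_sq_le {ϱ : ℝ} (hϱ : 0 < ϱ) (k : Position d) {r S : ℝ} (hr : 0 ≤ r) (hr1 : r ≤ 1)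
    (hS : (‖k‖ * r) ^ 2 ≤ S) :
    (‖k‖ ^ (-((d : ℝ) - 1) / 2) * r) ^ 2 ≤ lowFactor d ϱ k ^ 2 + S * highModulus d ϱ k ^ 2 := by
  by_cases h : ‖k‖ ≤ ϱ
  · have h' : ¬ ϱ < ‖k‖ := not_lt.2 h
    simp only [lowFactor, highModulus, h, h', if_true, if_false]
    have : (‖k‖ ^ (-((d : ℝ) - 1) / 2) * r) ^ 2 ≤ (‖k‖ ^ (-((d : ℝ) - 1) / 2)) ^ 2 :=
      pow_le_pow_left₀ (by positivity) (mul_le_of_le_one_right (by positivity) hr1) 2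
    simpa using this
  · have h' : ϱ < ‖k‖ := not_le.1 h
    have hk : 0 < ‖k‖ := hϱ.trans h'
    simp only [lowFactor, highModulus, h, h', if_true, if_false]
    have e : ‖k‖ ^ (-((d : ℝ) - 1) / 2) = ‖k‖ ^ (-((d : ℝ) + 1) / 2) * ‖k‖ := by
      nth_rewrite 3 [← Real.rpow_one ‖k‖]
      rw [← Real.rpow_add hk]
      congr 1
      ring
    rw [e, mul_assoc, mul_pow]
    have := mul_le_mul_of_nonneg_left hS (sq_nonneg (‖k‖ ^ (-((d : ℝ) + 1) / 2)))
    linarith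

end PolaronRadial

/-! ### The field generated by the particles and the polaron functional -/

section PolaronModel

variable {d N : ℕ}

/-- The field generated by the `j`-th particle. -/
noncomputable def polaronField (α : ℝ) (ψ : Wave d N) (j : Fin N) (k : Position d) : ℂ :=
  ∫ X, polaronFactor α (particle j X) k * (‖ψ X‖ ^ 2 : ℝ)

theorem polaronFactor_eq (α : ℝ) (j : Fin N) (k : Position d) (X : Config d N) :
    polaronFactor α (particle j X) k =
      √α * (‖k‖ ^ (-((d : ℝ) - 1) / 2) : ℝ) * starRingEnd ℂ (planeWave j k X) := by
  have h1 : starRingEnd ℂ (planeWave j k X) =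
      Complex.exp (-Complex.I * (⟪k, particle j X⟫_ℝ : ℝ)) := by
    rw [planeWave, ← Complex.exp_conj]
    simp
  rw [polaronFactor, h1, neg_div, Real.rpow_neg (norm_nonneg k)]
  push_cast
  ring

theorem polaronField_eq (α : ℝ) (ψ : Wave d N) (j : Fin N) (k : Position d) :
    polaronField α ψ j k =
      √α * (‖k‖ ^ (-((d : ℝ) - 1) / 2) : ℝ) * starRingEnd ℂ (densityFourier ψ j k) := by
  rw [polaronField, densityFourier, ← integral_conj, ← integral_const_mul]
  congr 1
  funext X
  rw [polaronFactor_eq]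
  simp only [map_mul, Complex.conj_ofReal]
  ring

theorem aestronglyMeasurable_polaronField (α : ℝ) (ψ : Wave d N) (j : Fin N) :
    AEStronglyMeasurable (polaronField α ψ j) := by
  have e : polaronField α ψ j = fun k =>
      √α * (‖k‖ ^ (-((d : ℝ) - 1) / 2) : ℝ) * starRingEnd ℂ (densityFourier ψ j k) :=
    funext fun k => polaronField_eq α ψ j k
  rw [e]
  refine AEStronglyMeasurable.mul ?_ ?_
  · have : Measurable fun k : Position d => (√α : ℂ) * ((‖k‖ ^ (-((d : ℝ) - 1) / 2) : ℝ) : ℂ) := by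
      fun_prop
    exact this.aestronglyMeasurable
  · exact Complex.continuous_conj.comp_aestronglyMeasurable
      (aestronglyMeasurable_densityFourier ψ j)

/-- At low momenta the density transform is bounded by `1`; at high momenta its decay gains a factor
`1/|k|` at the cost of the kinetic energy. The cut-off is free: any fixed value shows integrability,
a large one gives the lower bound. -/
theorem InH1.norm_polaronField_sq_le {ψ : Wave d N} (hψ : InH1 ψ) (h1 : ‖ψ‖ = 1) {α : ℝ}
    (hα : 0 < α) {ϱ : ℝ} (hϱ : 0 < ϱ) (j : Fin N) (k : Position d) :
    ‖polaronField α ψ j k‖ ^ 2 ≤ α * (lowFactor d ϱ k ^ 2 +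
      (4 * ∑ ℓ, ‖momentum ψ j ℓ‖ ^ 2) * highModulus d ϱ k ^ 2) := by
  have hr : ‖densityFourier ψ j k‖ ≤ 1 := by simpa [h1] using norm_densityFourier_le ψ j k
  have hS := hψ.norm_mul_densityFourier_sq_le j k
  rw [h1, one_pow, mul_one] at hS
  have h := rpow_mul_sq_le hϱ k (norm_nonneg _) hr hS
  rw [polaronField_eq, norm_mul, norm_mul, RCLike.norm_conj, Complex.norm_real, Complex.norm_real,
    Real.norm_of_nonneg (Real.sqrt_nonneg α), Real.norm_of_nonneg (by positivity), mul_assoc,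
    mul_pow, Real.sq_sqrt hα.le]
  exact mul_le_mul_of_nonneg_left h hα.le

theorem InH1.memLp_polaronField {ψ : Wave d N} (hψ : InH1 ψ) (h1 : ‖ψ‖ = 1) (hd : 0 < d) {α : ℝ}
    (hα : 0 < α) (j : Fin N) : MemLp (polaronField α ψ j) 2 := by
  refine (memLp_two_iff_integrable_sq_norm (aestronglyMeasurable_polaronField α ψ j)).2 ?_
  refine (((integrable_lowFactor_sq hd 1).add ((integrable_highModulus_sq hd one_pos).const_mul
    (4 * ∑ ℓ, ‖momentum ψ j ℓ‖ ^ 2))).const_mul α).mono'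
      ((aestronglyMeasurable_polaronField α ψ j).norm.pow 2)
      (Filter.Eventually.of_forall fun k => ?_)
  rw [Real.norm_of_nonneg (sq_nonneg _)]
  exact hψ.norm_polaronField_sq_le h1 hα one_pos j k

theorem InH1.integral_norm_polaronField_sq_le {ψ : Wave d N} (hψ : InH1 ψ) (h1 : ‖ψ‖ = 1)
    (hd : 0 < d) {α : ℝ} (hα : 0 < α) {ϱ : ℝ} (hϱ : 0 < ϱ) (j : Fin N) :
    ∫ k, ‖polaronField α ψ j k‖ ^ 2 ≤ α * ((∫ k : Position d, lowFactor d ϱ k ^ 2) +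
      (4 * ∑ ℓ, ‖momentum ψ j ℓ‖ ^ 2) * ∫ k : Position d, highModulus d ϱ k ^ 2) := by
  have i1 := integrable_lowFactor_sq hd ϱ
  have i2 := (integrable_highModulus_sq hd hϱ).const_mul (4 * ∑ ℓ, ‖momentum ψ j ℓ‖ ^ 2)
  rw [← integral_const_mul, ← integral_add i1 i2, ← integral_const_mul]
  exact integral_mono ((hψ.memLp_polaronField h1 hd hα j).integrable_norm_pow (p := 2) (by norm_num))
    ((i1.add i2).const_mul α) fun k => hψ.norm_polaronField_sq_le h1 hα hϱ j k

/-- The polaron potential does not depend on the momentum at which it is split. -/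
theorem InH1.polaronPotentialForm_eq {ψ : Wave d N} (hψ : InH1 ψ) (hd : 0 < d) (α : ℝ) {ϱ : ℝ}
    (hϱ : 0 < ϱ) (z : PhononSpace d) (j : Fin N) :
    polaronPotentialForm α ϱ z j ψ = 2 * (∫ k, ⟪z k, polaronField α ψ j k⟫_ℂ).re := by
  have hz := Lp.memLp z
  have hF : ∀ f : Position d → ℝ, MemLp f 2 → Integrable fun k => (f k : ℂ) * z k := by
    intro f hf
    exact (hf.ofReal (K := ℂ)).integrable_mul hz
  have hF0 := hF _ (memLp_lowFactor hd ϱ)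
  have hF1 := fun ℓ => hF _ (memLp_highFactor hd hϱ ℓ)
  have hρ : Integrable fun X => ((‖ψ X‖ ^ 2 : ℝ) : ℂ) := (integrable_norm_sq ψ).ofReal
  have hw : ∀ ℓ, Integrable fun X => starRingEnd ℂ (momentum ψ j ℓ X) * ψ X
      - starRingEnd ℂ (ψ X) * momentum ψ j ℓ X := fun ℓ =>
    (integrable_conj_mul (momentum ψ j ℓ) ψ).sub (integrable_conj_mul ψ (momentum ψ j ℓ))
  have hinv : ∀ (f : Position d → ℝ) (X : Config d N), invFourierInt f z (particle j X) =
      ∫ k, planeWave j k X * ((f k : ℂ) * z k) := by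
    intro f X
    simp only [invFourierInt, planeWave, mul_assoc]
  have hlow : ∫ X, invFourierInt (lowFactor d ϱ) z (particle j X) * (‖ψ X‖ ^ 2 : ℝ) =
      ∫ k, (lowFactor d ϱ k : ℂ) * z k * densityFourier ψ j k := by
    simp only [densityFourier]
    rw [← integral_mul_inverse_fourier hρ hF0 j]
    simp only [hinv, mul_comm]
  have hhigh : commutatorForm (fun ℓ => invFourierInt (highFactor d ϱ ℓ) z) j ψ =
      ∑ ℓ, ∫ k, (highFactor d ϱ ℓ k : ℂ) * z k * (k ℓ * densityFourier ψ j k) := by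
    rw [commutatorForm]
    refine Finset.sum_congr rfl fun ℓ _ => ?_
    simp only [← hψ.integral_current_planeWave]
    rw [← integral_mul_inverse_fourier (hw ℓ) (hF1 ℓ) j]
    congr 1
    funext X
    rw [hinv]
    ring
  have i1 : Integrable fun k => (lowFactor d ϱ k : ℂ) * z k * densityFourier ψ j k :=
    integrable_mul_fourier hρ hF0 j
  have i2 : ∀ ℓ, Integrable fun k => (highFactor d ϱ ℓ k : ℂ) * z k *
      (k ℓ * densityFourier ψ j k) := by
    intro ℓ
    simp only [← hψ.integral_current_planeWave]
    exact integrable_mul_fourier (hw ℓ) (hF1 ℓ) j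
  have htot : (∫ X, invFourierInt (lowFactor d ϱ) z (particle j X) * (‖ψ X‖ ^ 2 : ℝ)) +
      commutatorForm (fun ℓ => invFourierInt (highFactor d ϱ ℓ) z) j ψ =
      -- The low part plus the high parts weighted by `k_ℓ` recombine to the full radial factor,
      -- which no longer contains `ϱ`.
      ∫ k, ((‖k‖ ^ (-((d : ℝ) - 1) / 2) : ℝ) : ℂ) * z k * densityFourier ψ j k := by
    rw [hlow, hhigh, ← integral_finsetSum _ fun ℓ _ => i2 ℓ,
      ← integral_add i1 (integrable_finsetSum _ fun ℓ _ => i2 ℓ)]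
    congr 1
    funext k
    rw [← lowFactor_add_sum_highFactor hϱ k]
    push_cast
    rw [add_mul, add_mul, Finset.sum_mul, Finset.sum_mul]
    congr 1
    refine Finset.sum_congr rfl fun ℓ _ => ?_
    ring
  -- The inner product is antilinear in `z`, so it gives the complex conjugate of the potential
  -- integral; only the real part enters the form.
  have hin : ∫ k, ⟪z k, polaronField α ψ j k⟫_ℂ = √α * starRingEnd ℂ
      (∫ k, ((‖k‖ ^ (-((d : ℝ) - 1) / 2) : ℝ) : ℂ) * z k * densityFourier ψ j k) := by
    rw [← integral_conj, ← integral_const_mul]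
    congr 1
    funext k
    rw [polaronField_eq]
    simp only [RCLike.inner_apply, map_mul, Complex.conj_ofReal]
    ring
  rw [polaronPotentialForm, htot, hin, Complex.re_ofReal_mul, Complex.conj_re]
  ring

/-- Minimizing over the field costs at most `‖V ψ‖²`, and `‖V ψ‖²` is bounded by a constant plus a
small multiple of the kinetic energy, which the free form absorbs. -/
theorem polaron_variationalEquivalence (hd : 0 < d) {W : Config d N → ℝ} (hW : IsPotential W)
    {α : ℝ} (hα : 0 < α) {ϱ : ℝ} (hϱ : 0 < ϱ) :
    VariationalEquivalence (polaronEnergy α ϱ W) (LinearIsometryEquiv.refl ℂ (PhononSpace d))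
      (polaronFieldEq α) := by
  classical
  have hmem : ∀ ψ : Wave d N, InH1 ψ → ‖ψ‖ = 1 →
      MemLp (fun k => ∑ j, polaronField α ψ j k) 2 := fun ψ hψ h1 =>
    memLp_finsetSum _ fun j _ => hψ.memLp_polaronField h1 hd hα j
  let V : Wave d N → PhononSpace d := fun ψ =>
    if h : InH1 ψ ∧ ‖ψ‖ = 1 then (hmem ψ h.1 h.2).toLp _ else 0
  have hV : ∀ ψ : Wave d N, InH1 ψ → ‖ψ‖ = 1 → V ψ =ᵐ[volume] fun k => ∑ j, polaronField α ψ j k := by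
    intro ψ hψ h1
    simp only [V, dif_pos (And.intro hψ h1)]
    exact (hmem ψ hψ h1).coeFn_toLp
  -- This quantity will be the coefficient of the kinetic energy in the bound on `‖V ψ‖²`. The
  -- resulting cut-off `R` is chosen independently of the `ϱ` in the definition of the form.
  obtain ⟨n, hn⟩ : ∃ n : ℕ, 4 * N * α * ∫ k : Position d, highModulus d ((n : ℝ) + 1) k ^ 2 < 1 := by
    have h := (tendsto_integral_highModulus_sq hd).const_mul (4 * N * α)
    rw [mul_zero] at h
    exact (h.eventually_lt_const one_pos).exists
  set R : ℝ := (n : ℝ) + 1 with hR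
  have hR0 : 0 < R := by positivity
  set a := ∫ k : Position d, lowFactor d R k ^ 2
  set b := ∫ k : Position d, highModulus d R k ^ 2
  -- The prefactor `N` comes from Cauchy-Schwarz for the sum over the `N` particles.
  have hnorm : ∀ ψ : Wave d N, InH1 ψ → ‖ψ‖ = 1 →
      ‖V ψ‖ ^ 2 ≤ N * ∑ j, α * (a + (4 * ∑ ℓ, ‖momentum ψ j ℓ‖ ^ 2) * b) := by
    intro ψ hψ h1
    have hi := fun j => (hψ.memLp_polaronField h1 hd hα j).integrable_norm_pow (p := 2) (by norm_num)
    calc ‖V ψ‖ ^ 2 = ∫ k, ‖V ψ k‖ ^ 2 := (integral_norm_sq _).symm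
      _ ≤ ∫ k, N * ∑ j, ‖polaronField α ψ j k‖ ^ 2 := by
        refine integral_mono_ae (integrable_norm_sq _)
          ((integrable_finsetSum _ fun j _ => hi j).const_mul _) ?_
        filter_upwards [hV ψ hψ h1] with k hk
        rw [hk]
        refine (pow_le_pow_left₀ (norm_nonneg _) (norm_sum_le _ _) 2).trans ?_
        simpa using sq_sum_le_card_mul_sum_sq (s := Finset.univ)
          (f := fun j : Fin N => ‖polaronField α ψ j k‖)
      _ = N * ∑ j, ∫ k, ‖polaronField α ψ j k‖ ^ 2 := by
        rw [integral_const_mul, integral_finsetSum _ fun j _ => hi j]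
      _ ≤ _ := by
        gcongr with j _
        exact hψ.integral_norm_polaronField_sq_le h1 hd hα hR0 j
  -- The lower bound is minus the low-momentum part of the estimate of `‖V ψ‖²`: one `N` is from
  -- Cauchy-Schwarz, the other from summing the constant `α a` over the particles.
  refine variationalEquivalence_of_gradient (formDomain W)
    (fun ψ η => freeForm W ψ + 2 * (⟪η, V ψ⟫_ℂ).re + ‖η‖ ^ 2) (fun ψ η => η + V ψ)
    (-(N * (N * (α * a)))) ?_ ?_ ?_ ?_ ?_ ?_
  · intro ψ hψ z
    simp [polaronEnergy, hψ]
  · intro ψ hψ h1 η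
    have e : ∑ j, polaronPotentialForm α ϱ η j ψ = 2 * (⟪η, V ψ⟫_ℂ).re := by
      have hi : ∀ j, Integrable fun k => ⟪η k, polaronField α ψ j k⟫_ℂ := by
        intro j
        have hm := hψ.1.memLp_polaronField h1 hd hα j
        refine (L2.integrable_inner (𝕜 := ℂ) η (hm.toLp _)).congr ?_
        filter_upwards [hm.coeFn_toLp] with k hk
        rw [hk]
      simp only [hψ.1.polaronPotentialForm_eq hd α hϱ]
      rw [← Finset.mul_sum, ← Complex.re_sum, ← integral_finsetSum _ fun j _ => hi j, L2.inner_def]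
      congr 2
      refine integral_congr_ae ?_
      filter_upwards [hV ψ hψ.1 h1] with k hk
      rw [hk, inner_sum]
    change polaronEnergy α ϱ W ψ η = _
    simp only [polaronEnergy, hψ, if_true, e]
  · intro ψ hψ h1 η
    have h2 := linear_field_lower_bound (V ψ) η
    have h3 := kinetic_le_freeForm hW ψ
    have h4 := hnorm ψ hψ.1 h1
    have h5 : (N : ℝ) * ∑ j : Fin N, α * (a + (4 * ∑ ℓ, ‖momentum ψ j ℓ‖ ^ 2) * b) =
        N * (N * (α * a)) + (4 * N * α * b) * ∑ j, ∑ ℓ, ‖momentum ψ j ℓ‖ ^ 2 := by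
      simp only [mul_add, Finset.sum_add_distrib, Finset.sum_const, Finset.card_univ,
        Fintype.card_fin, nsmul_eq_mul]
      congr 1
      rw [Finset.mul_sum, Finset.mul_sum]
      refine Finset.sum_congr rfl fun j _ => ?_
      ring
    have h6 : 0 ≤ ∑ j, ∑ ℓ, ‖momentum ψ j ℓ‖ ^ 2 :=
      Finset.sum_nonneg fun j _ => Finset.sum_nonneg fun ℓ _ => sq_nonneg _
    have h7 := mul_le_of_le_one_left h6 hn.le
    linarith
  · intro ψ hψ h1
    exact hasStrongGradient_linear _ _
  · intro ψ hψ h1 η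
    have hfac : ∀ (k : Position d) (j : Fin N), Integrable fun X =>
        polaronFactor α (particle j X) k * (‖ψ X‖ ^ 2 : ℝ) := by
      intro k j
      simp only [polaronFactor_eq]
      have hb : MemLp (fun X => (√α : ℂ) * (‖k‖ ^ (-((d : ℝ) - 1) / 2) : ℝ)
          * starRingEnd ℂ (planeWave j k X)) ⊤ := (memLp_planeWave j k).star.const_mul _
      exact ((integrable_norm_sq ψ).ofReal (𝕜 := ℂ)).smul_of_top_right hb
    have e : ∀ k, ∫ X, (∑ j, polaronFactor α (particle j X) k) * (‖ψ X‖ ^ 2 : ℝ) =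
        ∑ j, polaronField α ψ j k := by
      intro k
      simp only [Finset.sum_mul, polaronField]
      exact integral_finsetSum _ fun j _ => hfac k j
    rw [polaronFieldEq, Lp.eq_zero_iff_ae_eq_zero]
    simp only [e]
    constructor
    · intro h
      filter_upwards [h, hV ψ hψ.1 h1, Lp.coeFn_add η (V ψ)] with k hk1 hk2 hk3
      rw [hk3, Pi.add_apply, hk2, hk1, Pi.zero_apply]
    · intro h
      filter_upwards [h, hV ψ hψ.1 h1, Lp.coeFn_add η (V ψ)] with k hk1 hk2 hk3
      rw [← hk2, ← Pi.add_apply, ← hk3, hk1, Pi.zero_apply]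
  · intro ψ hψ h1
    exact ⟨-V ψ, by simp⟩

end PolaronModel

theorem mainTheorem8 {𝔥 : Type*} [NormedAddCommGroup 𝔥] [InnerProductSpace ℂ 𝔥]
    [CompleteSpace 𝔥] (ω : Dispersion 𝔥) (N : ℕ) :
    -- (a) the Nelson model
    (∀ (d : ℕ) (_ : d ∈ ({1, 2, 3} : Set ℕ)) (W : Config d N → ℝ) (_ : IsPotential W)
        (lam : Position d → 𝔥) (_ : IsFormFactor ω lam),
      VariationalEquivalence (nelsonEnergy ω lam W) ω.halfIso (nelsonFieldEq ω lam)) ∧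
    -- (b) the polaron
    (∀ (d : ℕ) (_ : d ∈ ({1, 2, 3} : Set ℕ)) (W : Config d N → ℝ) (_ : IsPotential W)
        (α : ℝ) (_ : 0 < α) (ϱ : ℝ) (_ : 0 < ϱ),
      VariationalEquivalence (polaronEnergy α ϱ W) (LinearIsometryEquiv.refl ℂ (PhononSpace d))
        (polaronFieldEq α)) ∧
    -- (c) the Pauli-Fierz model
    (∀ (W : Config 3 N → ℝ) (_ : IsPotential W) (m : Fin N → ℝ) (_ : ∀ j, 0 < m j) (e : ℝ)
        (lam : Fin N → Fin 3 → Position 3 → 𝔥) (_ : ∀ j ℓ, IsFormFactor ω (lam j ℓ))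
        (_ : ∀ j ℓ, (∀ᵐ x, lam j ℓ x ∈ ω.half.domain) ∧
          MemLp (fun x => ω.halfApply (lam j ℓ x)) ⊤)
        (_ : ∀ j, IsDivergenceFree (lam j)),
      VariationalEquivalence (pauliFierzEnergy ω m e lam W) ω.halfIso
        (pauliFierzFieldEq ω m e lam)) := by
  refine ⟨?_, ?_, ?_⟩
  · intro d _ W hW lam hl
    exact nelson_variationalEquivalence ω hW hl
  · intro d hd W hW α hα ϱ hϱ
    have hd0 : 0 < d := by
      rcases hd with rfl | rfl | rfl <;> norm_num
    exact polaron_variationalEquivalence hd0 hW hα hϱ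
  · intro W hW m hm e lam hl _ hdiv
    exact pauliFierz_variationalEquivalence ω hW hm e hl hdiv
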